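/- **Setting.** Let $b>0$ (block reward), $\tau_0>0$ (mean interblock time), $0<q<1/2$, $p=1-q$, and let $z\ge 1$ and $A\ge \max(2,z)$ be integers. The honest miners and an attacker find blocks along two independent Poisson processes of rates $p/\tau_0$ and $q/\tau_0$. One attack cycle of the *$A$-Nakamoto double spend* of an amount $v\ge 0$ with $z$ confirmations runs as follows. The attacker mines on top of the official blockchain until he finds a block (time $\sigma$), which he keeps secret and extends to a secret fork. At a time $t\ge\sigma$ let $M(t)$ be the length of the secret fork (including the first secret block) and $H(t)$ the number of blocks that the honest miners have found since $\sigma$. The cycle ends at the first time $T_A\ge\sigma$ at which either $H\ge z$ and $M>H$ (success), or $H-M\ge A$ (the attacker gives up). The revenue $R_A$ of the cycle is $v+b\,M(T_A)$ in case of success and $0$ otherwise. The cycle ends almost surely and $R_A$, $T_A$ are integrable, with $\mathbb E[T_A]>0$; put $\Gamma_A=\mathbb E[R_A]/\mathbb E[T_A]$. The strategy is profitable if $\Gamma_A\ge\Gamma_H$, where $\Gamma_H=qb/\tau_0$ is the revenue ratio of honest mining. There is a least $v\ge 0$ with $\Gamma_A\ge\Gamma_H$; it is denoted $v_{\min}(q,A)$.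 **Statement.** Fix $b,\tau_0,z$ and put $$L_v(q)=\frac{b}{\tau_0}\left[2\binom{2z-1}{z}\left(\frac vb+1\right)+\frac{2}{B(z,z)}\right]q^{z+1},\qquad v_0(q)=\frac{q^{-z}\,b}{2\binom{2z-1}{z}},$$ where $B$ is the Beta function. 1. For every fixed $v\ge0$ and every $A\ge\max(2,z)$, $\Gamma_A\sim L_v(q)$ as $q\to0^+$; the equivalent does not depend on $A$. Moreover, for every $v\ge 0$ and $\varepsilon>0$ there is $\delta\in(0,1/2)$ such that, for all $0<q\le\delta$ and all $A\ge\max(2,z)$, we have $\Gamma_A\le(1+\varepsilon)L_v(q)$, and also $\Gamma_A\ge(1-\varepsilon)L_v(q)$ if $qA\le\delta$. 2. For every fixed $A\ge\max(2,z)$, the minimal profitable amount satisfies $v_{\min}(q,A)\sim v_0(q)$ as $q\to0^+$. Moreover, for every $\varepsilon>0$ there is $\delta\in(0,1/2)$ such that, for all $0<q\le\delta$, all $A\ge\max(2,z)$ and all $v\ge0$: if $\Gamma_A\ge\Gamma_H$ then $v\ge(1-\varepsilon)v_0(q)$; and if $qA\le\delta$ and $v\ge(1+\varepsilon)v_0(q)$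 then $\Gamma_A>\Gamma_H$. -/

import Mathlib

open MeasureTheory ProbabilityTheory Filter Topology Asymptotics

noncomputable section

namespace DoubleSpend

/-- A realization of the mining process during one attack cycle. `ω.1 k` is the `k`-th waiting time
between blocks of the honest miners, `ω.2 k` the `k`-th waiting time between blocks of the
attacker, with `k = 0, 1, 2, …` and time counted from the start of the cycle. -/
abbrev Path : Type := (ℕ → ℝ) × (ℕ → ℝ)

/-- The law of the mining process: the honest miners and the attacker find blocks along two
independent Poisson processes of rates `(1 - q) / τ₀` and `q / τ₀`, i.e. all waiting times are
independent and exponential with these rates. -/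
def law (q τ₀ : ℝ) : Measure Path :=
  (Measure.infinitePi fun _ : ℕ => expMeasure ((1 - q) / τ₀)).prod
    (Measure.infinitePi fun _ : ℕ => expMeasure (q / τ₀))

/-- The counting process of a sequence of waiting times `x 0, x 1, …`: the number of `n ≥ 1` such
that the `n`-th block, found at time `x 0 + ⋯ + x (n - 1)`, is found no later than `t`. -/
def blockCount (x : ℕ → ℝ) (t : ℝ) : ℕ :=
  Set.ncard {n : ℕ | 1 ≤ n ∧ ∑ k ∈ Finset.range n, x k ≤ t}

/-- The time at which the attacker finds his first block of the cycle, which he keeps secret (the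
pre-mined block). Until then he mines on top of the official blockchain and restarts whenever the
honest miners extend it, so that the secret fork starts with this block. -/
def preMineTime (ω : Path) : ℝ := ω.2 0

/-- Length of the secret fork at a time `t ≥ preMineTime ω`, the pre-mined block included. -/
def secretBlocks (ω : Path) (t : ℝ) : ℕ := blockCount ω.2 t

/-- Number of blocks added to the official blockchain between the pre-mining of the secret block
(when the transaction is sent to the vendor) and a time `t ≥ preMineTime ω`. -/
def officialBlocks (ω : Path) (t : ℝ) : ℕ :=
  blockCount ω.1 t - blockCount ω.1 (preMineTime ω)

/-- The double spend succeeds: the vendor's transaction has `z` confirmations and the secret fork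
is longer than the official blockchain. -/
def Succeeds (z : ℕ) (ω : Path) (t : ℝ) : Prop :=
  z ≤ officialBlocks ω t ∧ officialBlocks ω t < secretBlocks ω t

/-- The attacker gives up: his lag behind the official blockchain has reached `A`. -/
def GivesUp (A : ℕ) (ω : Path) (t : ℝ) : Prop :=
  secretBlocks ω t + A ≤ officialBlocks ω t

/-- The times, after the pre-mining phase, at which a reason to end the attack cycle is present. -/
def endTimes (z A : ℕ) (ω : Path) : Set ℝ :=
  {t | preMineTime ω ≤ t ∧ (Succeeds z ω t ∨ GivesUp A ω t)}

/-- The duration `T_A` of the attack cycle of the `A`-Nakamoto double spend. -/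
def duration (z A : ℕ) (ω : Path) : ℝ := sInf (endTimes z A ω)

open scoped Classical in
/-- The revenue `R_A` of the attack cycle: if the double spend succeeds, its amount `v` and the
reward `b` of every block of the secret fork; otherwise nothing. -/
def revenue (b v : ℝ) (z A : ℕ) (ω : Path) : ℝ :=
  if Succeeds z ω (duration z A ω) then v + b * (secretBlocks ω (duration z A ω) : ℝ) else 0

/-- The revenue ratio `Γ_A = E[R_A] / E[T_A]`. -/
def revenueRatio (τ₀ b v : ℝ) (z A : ℕ) (q : ℝ) : ℝ :=
  (∫ ω, revenue b v z A ω ∂(law q τ₀)) / ∫ ω, duration z A ω ∂(law q τ₀)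

/-- The revenue ratio `Γ_H = q b / τ₀` of honest mining. -/
def honestRatio (τ₀ b q : ℝ) : ℝ := q * b / τ₀

/-- The leading term `(b / τ₀) (2 C(2z-1,z) (v/b + 1) + 2 / B(z,z)) q ^ (z+1)` of `Γ_A`. -/
def leadingTerm (τ₀ b v : ℝ) (z : ℕ) (q : ℝ) : ℝ :=
  b / τ₀ * (2 * ((2 * z - 1).choose z : ℝ) * (v / b + 1) + 2 / beta z z) * q ^ (z + 1)

/-- The amounts `v ≥ 0` for which the `A`-Nakamoto double spend is profitable. -/
def profitableAmounts (τ₀ b : ℝ) (z A : ℕ) (q : ℝ) : Set ℝ :=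
  {v | 0 ≤ v ∧ honestRatio τ₀ b q ≤ revenueRatio τ₀ b v z A q}

/-- The minimal amount that makes the `A`-Nakamoto double spend profitable. -/
def minimalAmount (τ₀ b : ℝ) (z A : ℕ) (q : ℝ) : ℝ := sInf (profitableAmounts τ₀ b z A q)

/-- The threshold `v₀ = q ^ (-z) b / (2 C(2z-1,z))`. -/
def threshold (b : ℝ) (z : ℕ) (q : ℝ) : ℝ :=
  (q ^ z)⁻¹ / (2 * ((2 * z - 1).choose z : ℝ)) * b

end DoubleSpend

end

/-!
By memorylessness, the miners of the successive blocks are independent, each being the attacker with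
probability `q`, and the remaining waiting times are always as good as new. The pre-mining phase
thus takes `τ₀ / q` on average, and afterwards `H - M` is a random walk with fresh waiting times.
It drifts upwards, so that by Wald's identity the rest of the cycle takes only `O(A τ₀)`, whence
`E[T_A] = (τ₀ / q) (1 + O(q A))`.

When the attack succeeds, at least `2 z` blocks have been found since the pre-mining phase, at least
half of them by the attacker. Exactly `2 z` blocks, half of them by the attacker, have probability
`C(2z, z) q ^ z (1 - q) ^ z` and the revenue `v + b (z + 1)`; more blocks contribute only
`O(q ^ (z + 1/2))`, by Chernoff's bound. Hence `Γ_A ∼ C(2z, z) (v + b (z + 1)) q ^ (z + 1) / τ₀`,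
and this is `L_v(q)` because `C(2z, z) = 2 C(2z-1, z)` and `1 / B(z, z) = z C(2z-1, z)`.
Since `v₀(q) → ∞`, the term `b (z + 1)` is negligible for `v` near `v₀(q)`, and comparing `L_v` with
`Γ_H` then amounts to comparing `v` with `v₀`.
-/

noncomputable section

namespace DoubleSpend

open scoped ENNReal

/-! ### Exponential waiting times -/

lemma lintegral_expMeasure (r : ℝ) {f : ℝ → ℝ≥0∞} (hf : Measurable f) :
    ∫⁻ x, f x ∂expMeasure r = ∫⁻ x, exponentialPDF r x * f x :=
  lintegral_withDensity_eq_lintegral_mul _ (measurable_exponentialPDFReal r).ennreal_ofReal hf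

instance (r : ℝ) : NullSingletonClass (expMeasure r) where
  measure_singleton x := withDensity_absolutelyContinuous volume (exponentialPDF r) (by simp)

lemma ae_pos_expMeasure (r : ℝ) : ∀ᵐ x ∂expMeasure r, 0 < x := by
  have h : expMeasure r (Set.Iio 0) = 0 :=
    (withDensity_apply _ measurableSet_Iio).trans (lintegral_exponentialPDF_of_nonpos le_rfl)
  rw [measure_congr Iio_ae_eq_Iic] at h
  simpa [ae_iff, Set.Iic_def] using h

lemma setLIntegral_Ici_sub_expMeasure {r s : ℝ} (hs : 0 ≤ s) {f : ℝ → ℝ≥0∞} (hf : Measurable f) :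
    ∫⁻ y in Set.Ici s, f (y - s) ∂expMeasure r
      = ENNReal.ofReal (Real.exp (-(r * s))) * ∫⁻ y, f y ∂expMeasure r := by
  have hm : Measurable ((Set.Ici s).indicator fun y => f (y - s)) :=
    (hf.comp (measurable_id.sub_const s)).indicator measurableSet_Ici
  rw [← lintegral_indicator measurableSet_Ici, lintegral_expMeasure r hm,
    lintegral_expMeasure r hf, ← lintegral_add_right_eq_self _ s,
    ← lintegral_const_mul' _ _ ENNReal.ofReal_ne_top]
  refine lintegral_congr fun y => ?_
  rcases le_or_gt 0 y with hy | hy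
  · rw [Set.indicator_of_mem (by simpa using hy), add_sub_cancel_right,
      exponentialPDF_of_nonneg hy, exponentialPDF_of_nonneg (by positivity), ← mul_assoc,
      ← ENNReal.ofReal_mul (Real.exp_pos _).le, mul_left_comm, ← Real.exp_add]
    ring_nf
  · rw [Set.indicator_of_notMem (by simpa using hy), exponentialPDF_of_neg hy]
    simp

lemma lintegral_exp_neg_mul_expMeasure {α β : ℝ} (hα : 0 < α) (hβ : 0 < β) :
    ∫⁻ x, ENNReal.ofReal (Real.exp (-(β * x))) ∂expMeasure α
      = ENNReal.ofReal (α / (α + β)) := by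
  rw [lintegral_expMeasure _ (by fun_prop), ← mul_one (ENNReal.ofReal (α / (α + β))),
    ← lintegral_exponentialPDF_eq_one (add_pos hα hβ),
    ← lintegral_const_mul' _ _ ENNReal.ofReal_ne_top]
  refine lintegral_congr fun x => ?_
  rcases le_or_gt 0 x with hx | hx
  · rw [exponentialPDF_of_nonneg hx, exponentialPDF_of_nonneg hx,
      ← ENNReal.ofReal_mul (by positivity), ← ENNReal.ofReal_mul (by positivity),
      mul_assoc α, ← Real.exp_add]
    congr 1
    field_simp
    ring_nf
  · simp [exponentialPDF_of_neg hx]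

lemma lintegral_id_expMeasure {r : ℝ} (hr : 0 < r) :
    ∫⁻ x, ENNReal.ofReal x ∂expMeasure r = ENNReal.ofReal r⁻¹ := by
  -- `x * exponentialPDF r x` is `r⁻¹` times the density of the Gamma law of shape `2`.
  rw [lintegral_expMeasure _ (by fun_prop), ← mul_one (ENNReal.ofReal r⁻¹),
    ← lintegral_gammaPDF_eq_one (a := 2) two_pos hr,
    ← lintegral_const_mul' _ _ ENNReal.ofReal_ne_top]
  refine lintegral_congr fun x => ?_
  rcases le_or_gt 0 x with hx | hx
  · rw [exponentialPDF_of_nonneg hx, gammaPDF_of_nonneg hx,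
      ← ENNReal.ofReal_mul (by positivity), ← ENNReal.ofReal_mul (by positivity),
      Real.Gamma_two, show (2 : ℝ) - 1 = 1 by norm_num, Real.rpow_one, Real.rpow_two]
    congr 1
    field_simp
  · simp [exponentialPDF_of_neg hx, gammaPDF_of_neg hx]

lemma lintegral_race {α β : ℝ} (hα : 0 < α) (hβ : 0 < β) {f : ℝ → ℝ≥0∞} (hf : Measurable f) :
    ∫⁻ x, ∫⁻ y in Set.Ici x, f (y - x) ∂expMeasure β ∂expMeasure α
      = ENNReal.ofReal (α / (α + β)) * ∫⁻ y, f y ∂expMeasure β := by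
  rw [lintegral_congr_ae ((ae_pos_expMeasure α).mono fun x hx =>
      setLIntegral_Ici_sub_expMeasure hx.le hf), lintegral_mul_const _ (by fun_prop),
    lintegral_exp_neg_mul_expMeasure hα hβ]

/-! ### Sequences of independent waiting times -/

section Sequence

variable {α : Type*}

/-- The sequence `a, x 0, x 1, …`. -/
def seqCons (a : α) (x : ℕ → α) : ℕ → α
  | 0 => a
  | n + 1 => x n

/-- The sequence `x 1, x 2, …`. -/
def seqTail (x : ℕ → α) : ℕ → α := fun n => x (n + 1)

@[simp] lemma seqCons_zero (a : α) (x : ℕ → α) : seqCons a x 0 = a := rfl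

@[simp] lemma seqCons_succ (a : α) (x : ℕ → α) (n : ℕ) : seqCons a x (n + 1) = x n := rfl

@[simp] lemma seqTail_apply (x : ℕ → α) (n : ℕ) : seqTail x n = x (n + 1) := rfl

@[simp] lemma seqTail_seqCons (a : α) (x : ℕ → α) : seqTail (seqCons a x) = x := rfl

lemma preimage_seqCons_pi (s : Finset ℕ) (t : ℕ → Set α) :
    (fun p : α × (ℕ → α) => seqCons p.1 p.2) ⁻¹' (s : Set ℕ).pi t
      = (if 0 ∈ s then t 0 else Set.univ) ×ˢ
        ((s.preimage Nat.succ Nat.succ_injective.injOn : Finset ℕ) : Set ℕ).pi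
          fun i => t (i + 1) := by
  ext ⟨a, x⟩
  simp only [Set.mem_preimage, Set.mem_pi, Finset.mem_coe, Set.mem_prod, Finset.mem_preimage,
    Nat.succ_eq_add_one]
  constructor
  · intro h
    refine ⟨?_, fun i hi => h (i + 1) hi⟩
    split_ifs with h0
    · exact h 0 h0
    · trivial
  · rintro ⟨h0, h⟩ (_ | i) hi
    · simpa [hi] using h0
    · exact h i hi

variable [MeasurableSpace α]

@[fun_prop]
lemma measurable_seqTail : Measurable (seqTail : (ℕ → α) → ℕ → α) :=
  measurable_pi_lambda _ fun n => measurable_pi_apply (n + 1)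

@[fun_prop]
lemma measurable_seqCons {Ω : Type*} [MeasurableSpace Ω] {a : Ω → α} {x : Ω → ℕ → α}
    (ha : Measurable a) (hx : Measurable x) : Measurable fun ω => seqCons (a ω) (x ω) := by
  refine measurable_pi_lambda _ fun n => ?_
  cases n with
  | zero => exact ha
  | succ n => exact (measurable_pi_apply n).comp hx

lemma map_seqCons_infinitePi (ν : Measure α) [IsProbabilityMeasure ν] :
    (ν.prod (Measure.infinitePi fun _ : ℕ => ν)).map (fun p => seqCons p.1 p.2)
      = Measure.infinitePi fun _ : ℕ => ν := by
  refine Measure.eq_infinitePi _ fun s t ht => ?_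
  rw [Measure.map_apply (by fun_prop) (.pi s.countable_toSet fun i _ => ht i),
    preimage_seqCons_pi, Measure.prod_prod, Measure.infinitePi_pi _ (fun i _ => ht _)]
  have tail : ∏ i ∈ s.preimage Nat.succ Nat.succ_injective.injOn, ν (t (i + 1))
      = ∏ i ∈ s.erase 0, ν (t i) := by
    have himage : (s.preimage Nat.succ Nat.succ_injective.injOn).image Nat.succ = s.erase 0 := by
      ext (_ | i) <;> simp
    rw [← himage, Finset.prod_image Nat.succ_injective.injOn]
  rw [tail]
  split_ifs with h0
  · exact Finset.mul_prod_erase s (fun i => ν (t i)) h0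
  · rw [measure_univ, one_mul, Finset.erase_eq_of_notMem h0]

lemma lintegral_infinitePi_eq_seqCons (ν : Measure α) [IsProbabilityMeasure ν]
    {f : (ℕ → α) → ℝ≥0∞} (hf : Measurable f) :
    ∫⁻ x, f x ∂(Measure.infinitePi fun _ : ℕ => ν)
      = ∫⁻ a, ∫⁻ x, f (seqCons a x) ∂(Measure.infinitePi fun _ : ℕ => ν) ∂ν := by
  conv_lhs => rw [← map_seqCons_infinitePi ν]
  rw [lintegral_map hf (by fun_prop), lintegral_prod _ (by fun_prop)]

end Sequence

section Law

variable {q τ₀ : ℝ}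

lemma lintegral_law_eq_seqCons_fst (hτ : 0 < τ₀) (hq : 0 < q) (hq1 : q < 1) {f : Path → ℝ≥0∞}
    (hf : Measurable f) :
    ∫⁻ ω, f ω ∂law q τ₀
      = ∫⁻ a, ∫⁻ ω, f (seqCons a ω.1, ω.2) ∂law q τ₀ ∂expMeasure ((1 - q) / τ₀) := by
  have := isProbabilityMeasure_expMeasure (r := (1 - q) / τ₀) (div_pos (by linarith) hτ)
  have := isProbabilityMeasure_expMeasure (r := q / τ₀) (div_pos hq hτ)
  unfold law
  rw [lintegral_prod _ hf.aemeasurable, lintegral_infinitePi_eq_seqCons _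
    (Measurable.lintegral_prod_right' hf)]
  refine lintegral_congr fun a => ?_
  rw [lintegral_prod _ (by fun_prop)]

lemma lintegral_law_eq_seqCons_snd (hτ : 0 < τ₀) (hq : 0 < q) (hq1 : q < 1) {f : Path → ℝ≥0∞}
    (hf : Measurable f) :
    ∫⁻ ω, f ω ∂law q τ₀
      = ∫⁻ b, ∫⁻ ω, f (ω.1, seqCons b ω.2) ∂law q τ₀ ∂expMeasure (q / τ₀) := by
  have := isProbabilityMeasure_expMeasure (r := (1 - q) / τ₀) (div_pos (by linarith) hτ)
  have := isProbabilityMeasure_expMeasure (r := q / τ₀) (div_pos hq hτ)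
  unfold law
  rw [lintegral_prod_symm _ hf.aemeasurable, lintegral_infinitePi_eq_seqCons _
    (Measurable.lintegral_prod_left' hf)]
  refine lintegral_congr fun a => ?_
  rw [lintegral_prod_symm _ (by fun_prop)]

lemma isProbabilityMeasure_law (hτ : 0 < τ₀) (hq : 0 < q) (hq1 : q < 1) :
    IsProbabilityMeasure (law q τ₀) := by
  have := isProbabilityMeasure_expMeasure (r := (1 - q) / τ₀) (div_pos (by linarith) hτ)
  have := isProbabilityMeasure_expMeasure (r := q / τ₀) (div_pos hq hτ)
  unfold law
  infer_instance

end Law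

/-! ### The next block -/

/-- Whether the next block is found by the attacker. -/
def bit (ω : Path) : Bool := decide (ω.2 0 ≤ ω.1 0)

/-- The waiting time until the next block. -/
def wait (ω : Path) : ℝ := min (ω.1 0) (ω.2 0)

/-- The waiting times that remain after the next block has been found: a new one for the miner who
found it, the rest of the current one for the other miner. -/
def residual (ω : Path) : Path :=
  if ω.2 0 ≤ ω.1 0 then (seqCons (ω.1 0 - ω.2 0) (seqTail ω.1), seqTail ω.2)
  else (seqTail ω.1, seqCons (ω.2 0 - ω.1 0) (seqTail ω.2))

lemma measurableSet_attacker_next : MeasurableSet {ω : Path | ω.2 0 ≤ ω.1 0} :=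
  measurableSet_le (by fun_prop) (by fun_prop)

@[fun_prop]
lemma measurable_residual : Measurable residual :=
  Measurable.ite measurableSet_attacker_next (by fun_prop) (by fun_prop)

@[fun_prop]
lemma measurable_bit : Measurable bit :=
  measurable_to_bool (by simpa [bit, Set.preimage] using measurableSet_attacker_next)

@[fun_prop]
lemma measurable_wait : Measurable wait := by unfold wait; fun_prop

/-- The probability that a block is found by the attacker (`true`) or by the honest miners
(`false`). -/
def prob (q : ℝ) (c : Bool) : ℝ≥0∞ := ENNReal.ofReal (if c then q else 1 - q)

lemma prob_add {q : ℝ} (hq : 0 < q) (hq1 : q < 1) : prob q false + prob q true = 1 := by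
  simp only [prob, Bool.false_eq_true, if_true, if_false]
  rw [← ENNReal.ofReal_add (by linarith) hq.le, sub_add_cancel, ENNReal.ofReal_one]

section Law

variable {q τ₀ : ℝ}

lemma setLIntegral_honest_next (hτ : 0 < τ₀) (hq : 0 < q) (hq1 : q < 1) {g : Path → ℝ≥0∞}
    (hg : Measurable g) :
    ∫⁻ ω in {ω | ω.2 0 ≤ ω.1 0}ᶜ, g (residual ω) ∂law q τ₀
      = prob q false * ∫⁻ ω, g ω ∂law q τ₀ := by
  have := isProbabilityMeasure_law hτ hq hq1
  have hs := measurableSet_attacker_next.compl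
  have hgs : Measurable ({ω : Path | ω.2 0 ≤ ω.1 0}ᶜ.indicator fun ω => g (residual ω)) :=
    (hg.comp measurable_residual).indicator hs
  have hrest : Measurable fun s => ∫⁻ ω, g (ω.1, seqCons s ω.2) ∂law q τ₀ :=
    Measurable.lintegral_prod_right' (f := fun p : ℝ × Path => g (p.2.1, seqCons p.1 p.2.2))
      (by fun_prop)
  have hp : (1 - q) / τ₀ / ((1 - q) / τ₀ + q / τ₀) = 1 - q := by field_simp; ring
  have race := lintegral_race (div_pos (sub_pos.2 hq1) hτ) (div_pos hq hτ) hrest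
  rw [hp, ← lintegral_law_eq_seqCons_snd hτ hq hq1 hg] at race
  refine Eq.trans ?_ race
  rw [← lintegral_indicator hs, lintegral_law_eq_seqCons_fst hτ hq hq1 hgs]
  refine lintegral_congr fun a => ?_
  rw [lintegral_law_eq_seqCons_snd hτ hq hq1 (f := fun ω => Set.indicator _ _ (seqCons a ω.1, ω.2))
      (hgs.comp (by fun_prop)),
    ← setLIntegral_congr Ioi_ae_eq_Ici, ← lintegral_indicator measurableSet_Ioi]
  refine lintegral_congr fun b => ?_
  by_cases h : b ≤ a
  · simp [Set.indicator, h, not_lt.2 h]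
  · simp [Set.indicator, h, not_le.1 h, residual]

lemma setLIntegral_attacker_next (hτ : 0 < τ₀) (hq : 0 < q) (hq1 : q < 1) {g : Path → ℝ≥0∞}
    (hg : Measurable g) :
    ∫⁻ ω in {ω | ω.2 0 ≤ ω.1 0}, g (residual ω) ∂law q τ₀
      = prob q true * ∫⁻ ω, g ω ∂law q τ₀ := by
  have := isProbabilityMeasure_law hτ hq hq1
  have hs := measurableSet_attacker_next
  have hgs : Measurable ({ω : Path | ω.2 0 ≤ ω.1 0}.indicator fun ω => g (residual ω)) :=
    (hg.comp measurable_residual).indicator hs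
  have hrest : Measurable fun s => ∫⁻ ω, g (seqCons s ω.1, ω.2) ∂law q τ₀ :=
    Measurable.lintegral_prod_right' (f := fun p : ℝ × Path => g (seqCons p.1 p.2.1, p.2.2))
      (by fun_prop)
  have hp : q / τ₀ / (q / τ₀ + (1 - q) / τ₀) = q := by field_simp; ring
  have race := lintegral_race (div_pos hq hτ) (div_pos (sub_pos.2 hq1) hτ) hrest
  rw [hp, ← lintegral_law_eq_seqCons_fst hτ hq hq1 hg] at race
  refine Eq.trans ?_ race
  rw [← lintegral_indicator hs, lintegral_law_eq_seqCons_snd hτ hq hq1 hgs]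
  refine lintegral_congr fun b => ?_
  rw [lintegral_law_eq_seqCons_fst hτ hq hq1 (f := fun ω => Set.indicator _ _ (ω.1, seqCons b ω.2))
      (hgs.comp (by fun_prop)), ← lintegral_indicator measurableSet_Ici]
  refine lintegral_congr fun a => ?_
  by_cases h : b ≤ a <;> simp [Set.indicator, h, residual]

lemma lintegral_bit_residual (hτ : 0 < τ₀) (hq : 0 < q) (hq1 : q < 1) {g : Bool → Path → ℝ≥0∞}
    (hg : ∀ c, Measurable (g c)) :
    ∫⁻ ω, g (bit ω) (residual ω) ∂law q τ₀
      = prob q false * ∫⁻ ω, g false ω ∂law q τ₀ + prob q true * ∫⁻ ω, g true ω ∂law q τ₀ := by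
  have hs := measurableSet_attacker_next
  rw [← lintegral_add_compl _ hs, add_comm, ← setLIntegral_honest_next hτ hq hq1 (hg false),
    ← setLIntegral_attacker_next hτ hq hq1 (hg true)]
  congr 1
  · exact setLIntegral_congr_fun hs.compl fun ω hω => by
      simp only [bit, decide_eq_false (show ¬ω.2 0 ≤ ω.1 0 from hω)]
  · exact setLIntegral_congr_fun hs fun ω hω => by
      simp only [bit, decide_eq_true (show ω.2 0 ≤ ω.1 0 from hω)]

lemma law_bit_residual (hτ : 0 < τ₀) (hq : 0 < q) (hq1 : q < 1) {s : Bool → Set Path}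
    (hs : ∀ c, MeasurableSet (s c)) :
    law q τ₀ {ω | residual ω ∈ s (bit ω)}
      = prob q false * law q τ₀ (s false) + prob q true * law q τ₀ (s true) := by
  have hpre : MeasurableSet {ω | residual ω ∈ s (bit ω)} :=
    (MeasurableSet.iUnion fun c => (measurable_bit (measurableSet_singleton c)).inter
      (measurable_residual (hs c))).congr (by ext; simp)
  simp only [← lintegral_indicator_one (hs _), ← lintegral_indicator_one hpre]
  exact lintegral_bit_residual hτ hq hq1 (g := fun c => (s c).indicator 1)
    fun c => measurable_one.indicator (hs c)

lemma measurePreserving_residual (hτ : 0 < τ₀) (hq : 0 < q) (hq1 : q < 1) :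
    MeasurePreserving residual (law q τ₀) (law q τ₀) := by
  refine ⟨measurable_residual, Measure.ext_of_lintegral _ fun g hg => ?_⟩
  rw [lintegral_map hg measurable_residual,
    lintegral_bit_residual hτ hq hq1 (g := fun _ => g) (fun _ => hg), ← add_mul,
    prob_add hq hq1, one_mul]

end Law

/-! ### The sequence of miners -/

/-- The miners of the first `n` blocks. -/
def bits (n : ℕ) (ω : Path) : List Bool := (List.range n).map fun k => bit (residual^[k] ω)

@[simp] lemma bits_zero (ω : Path) : bits 0 ω = [] := rfl

@[simp] lemma length_bits (n : ℕ) (ω : Path) : (bits n ω).length = n := by simp [bits]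

lemma bits_add (m n : ℕ) (ω : Path) : bits (m + n) ω = bits m ω ++ bits n (residual^[m] ω) := by
  simp [bits, List.range_add, ← Function.iterate_add_apply, add_comm, Function.comp_def]

lemma bits_succ (n : ℕ) (ω : Path) : bits (n + 1) ω = bit ω :: bits n (residual ω) := by
  rw [add_comm, bits_add]; rfl

lemma bits_succ' (n : ℕ) (ω : Path) : bits (n + 1) ω = bits n ω ++ [bit (residual^[n] ω)] :=
  bits_add n 1 ω

@[fun_prop]
lemma measurable_iterate_residual (n : ℕ) : Measurable residual^[n] :=
  measurable_residual.iterate n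

lemma measurable_comp_bits {β : Type*} [MeasurableSpace β] (F : List Bool → β) (n : ℕ) :
    Measurable fun ω => F (bits n ω) := by
  induction n generalizing F with
  | zero => exact measurable_const (a := F [])
  | succ n ih =>
    have h : (fun ω => F (bits (n + 1) ω)) = fun ω =>
        if bit ω = true then F (true :: bits n (residual ω))
        else F (false :: bits n (residual ω)) := by
      ext ω
      cases hb : bit ω <;> simp [bits_succ, hb]
    rw [h]
    exact Measurable.ite (measurable_bit (measurableSet_singleton true))
      ((ih fun l => F (true :: l)).comp measurable_residual)
      ((ih fun l => F (false :: l)).comp measurable_residual)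

lemma measurableSet_bits (P : List Bool → Prop) (n : ℕ) : MeasurableSet {ω | P (bits n ω)} :=
  measurableSet_setOfPred.2 (measurable_comp_bits P n)

section Law

variable {q τ₀ : ℝ}

lemma lintegral_bits_succ_mul (hτ : 0 < τ₀) (hq : 0 < q) (hq1 : q < 1) (n : ℕ)
    (F : List Bool → ℝ≥0∞) {g : Path → ℝ≥0∞} (hg : Measurable g) :
    ∫⁻ ω, F (bits (n + 1) ω) * g (residual^[n + 1] ω) ∂law q τ₀
      = prob q false * ∫⁻ ω, F (false :: bits n ω) * g (residual^[n] ω) ∂law q τ₀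
        + prob q true * ∫⁻ ω, F (true :: bits n ω) * g (residual^[n] ω) ∂law q τ₀ := by
  simp only [bits_succ, Function.iterate_succ_apply]
  exact lintegral_bit_residual hτ hq hq1
    (g := fun c ω => F (c :: bits n ω) * g (residual^[n] ω))
    fun c => (measurable_comp_bits (fun l => F (c :: l)) n).mul (by fun_prop)

lemma lintegral_bits_succ (hτ : 0 < τ₀) (hq : 0 < q) (hq1 : q < 1) (n : ℕ)
    (F : List Bool → ℝ≥0∞) :
    ∫⁻ ω, F (bits (n + 1) ω) ∂law q τ₀
      = prob q false * ∫⁻ ω, F (false :: bits n ω) ∂law q τ₀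
        + prob q true * ∫⁻ ω, F (true :: bits n ω) ∂law q τ₀ := by
  simpa using lintegral_bits_succ_mul hτ hq hq1 n F (g := 1) measurable_one

lemma lintegral_bits_succ' (hτ : 0 < τ₀) (hq : 0 < q) (hq1 : q < 1) (n : ℕ)
    (F : List Bool → ℝ≥0∞) :
    ∫⁻ ω, F (bits (n + 1) ω) ∂law q τ₀
      = prob q false * ∫⁻ ω, F (bits n ω ++ [false]) ∂law q τ₀
        + prob q true * ∫⁻ ω, F (bits n ω ++ [true]) ∂law q τ₀ := by
  induction n generalizing F with
  | zero => exact lintegral_bits_succ hτ hq hq1 0 F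
  | succ n ih =>
    rw [lintegral_bits_succ hτ hq hq1, ih fun l => F (false :: l), ih fun l => F (true :: l),
      lintegral_bits_succ hτ hq hq1 n fun l => F (l ++ [false]),
      lintegral_bits_succ hτ hq hq1 n fun l => F (l ++ [true])]
    simp only [List.cons_append]
    ring

lemma lintegral_bits_mul (hτ : 0 < τ₀) (hq : 0 < q) (hq1 : q < 1) (n : ℕ) (F : List Bool → ℝ≥0∞)
    {g : Path → ℝ≥0∞} (hg : Measurable g) :
    ∫⁻ ω, F (bits n ω) * g (residual^[n] ω) ∂law q τ₀
      = (∫⁻ ω, F (bits n ω) ∂law q τ₀) * ∫⁻ ω, g ω ∂law q τ₀ := by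
  induction n generalizing F with
  | zero =>
    have := isProbabilityMeasure_law hτ hq hq1
    simp [lintegral_const_mul _ hg]
  | succ n ih =>
    rw [lintegral_bits_succ_mul hτ hq hq1 n F hg, ih fun l => F (false :: l),
      ih fun l => F (true :: l), lintegral_bits_succ hτ hq hq1]
    ring

lemma lintegral_pow_count (hτ : 0 < τ₀) (hq : 0 < q) (hq1 : q < 1) (n : ℕ) (c : ℝ≥0∞) :
    ∫⁻ ω, c ^ (bits n ω).count true ∂law q τ₀ = (prob q false + prob q true * c) ^ n := by
  induction n with
  | zero =>
    have := isProbabilityMeasure_law hτ hq hq1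
    simp
  | succ n ih =>
    have h : ∫⁻ ω, c ^ ((bits n ω).count true + 1) ∂law q τ₀
        = c * (prob q false + prob q true * c) ^ n := by
      simp only [pow_succ', ← ih]
      exact lintegral_const_mul _ (measurable_comp_bits (fun l => c ^ l.count true) n)
    rw [lintegral_bits_succ hτ hq hq1 n fun l => c ^ l.count true]
    simp only [List.count_cons_self, List.count_cons_of_ne Bool.false_ne_true, h, ih]
    ring

lemma law_bits_succ (hτ : 0 < τ₀) (hq : 0 < q) (hq1 : q < 1) (n : ℕ) (P : List Bool → Prop) :
    law q τ₀ {ω | P (bits (n + 1) ω)}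
      = prob q false * law q τ₀ {ω | P (false :: bits n ω)}
        + prob q true * law q τ₀ {ω | P (true :: bits n ω)} := by
  simp only [bits_succ]
  exact law_bit_residual hτ hq hq1 (s := fun c => {ω | P (c :: bits n ω)})
    fun c => measurableSet_bits (fun l => P (c :: l)) n

lemma law_count_eq (hτ : 0 < τ₀) (hq : 0 < q) (hq1 : q < 1) (n k : ℕ) :
    law q τ₀ {ω | (bits n ω).count true = k}
      = n.choose k * prob q true ^ k * prob q false ^ (n - k) := by
  have := isProbabilityMeasure_law hτ hq hq1
  induction n generalizing k with
  | zero => cases k <;> simp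
  | succ n ih =>
    rw [law_bits_succ hτ hq hq1 n fun l => l.count true = k]
    simp only [List.count_cons_self, List.count_cons_of_ne Bool.false_ne_true]
    rcases k with _ | k
    · simp [ih, pow_succ']
    · simp only [Nat.add_right_cancel_iff, ih, Nat.choose_succ_succ, Nat.succ_eq_add_one,
        Nat.add_sub_add_right, Nat.cast_add]
      rcases lt_or_ge k n with hk | hk
      · obtain ⟨m, rfl⟩ := Nat.exists_eq_add_of_lt hk
        rw [show k + m + 1 - (k + 1) = m by lia, show k + m + 1 - k = m + 1 by lia]
        ring
      · rw [Nat.choose_eq_zero_of_lt (Nat.lt_succ_of_le hk)]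
        push_cast
        ring

/-- First-step analysis: an event that happens or is decided anew after each honest block. -/
lemma eq_of_eq_prob_mul_add (hq : 0 < q) (hq1 : q < 1) {x y : ℝ≥0∞} (hx : x ≠ ∞)
    (h : x = prob q false * x + prob q true * y) : x = y := by
  have hp : prob q false * x ≠ ∞ := ENNReal.mul_ne_top ENNReal.ofReal_ne_top hx
  have key : prob q false * x + prob q true * x = prob q false * x + prob q true * y := by
    rw [← add_mul, prob_add hq hq1, one_mul, ← h]
  have hq' : prob q true ≠ 0 := by simpa [prob] using hq
  exact (ENNReal.mul_right_inj hq' ENNReal.ofReal_ne_top).1 ((ENNReal.add_right_inj hp).1 key)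

end Law

/-! ### The pre-mining phase -/

lemma measurable_sInf_nat {Ω : Type*} [MeasurableSpace Ω] {p : Ω → ℕ → Prop}
    (hp : ∀ k, MeasurableSet {ω | p ω k}) : Measurable fun ω => sInf {n | p ω n} := by
  classical
  -- `sInf ∅ = 0`, so an `ω` without any `n` has to be sent to `0`.
  have hex : ∀ ω, ∃ n, p ω n ∨ ∀ m, ¬p ω m := fun ω => by
    by_cases h : ∃ n, p ω n
    · exact h.imp fun _ => Or.inl
    · exact ⟨0, Or.inr (not_exists.1 h)⟩
  have hfind : (fun ω => sInf {n | p ω n}) = fun ω => Nat.find (hex ω) := by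
    ext ω
    by_cases h : ∃ n, p ω n
    · rw [Nat.sInf_def (s := {n | p ω n}) h]
      exact Nat.find_congr' (by simp [not_forall_not.2 h])
    · rw [not_exists] at h
      rw [(Nat.find_eq_zero (hex ω)).2 (Or.inr h)]
      simp [h]
  rw [hfind]
  refine measurable_find hex fun k => ?_
  exact ((hp k).union (MeasurableSet.iInter fun m => (hp m).compl)).congr (by ext; simp)

lemma measurable_eval_nat {Ω β : Type*} [MeasurableSpace Ω] [MeasurableSpace β] {N : Ω → ℕ}
    (hN : Measurable N) {f : ℕ → Ω → β} (hf : ∀ n, Measurable (f n)) :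
    Measurable fun ω => f (N ω) ω :=
  (measurable_from_prod_countable_right (f := fun p : ℕ × Ω => f p.1 p.2) hf).comp
    (hN.prodMk measurable_id)

/-- The number of honest blocks found before the first block of the attacker. -/
def firstAttack (ω : Path) : ℕ := sInf {n | bit (residual^[n] ω) = true}

/-- The waiting times after the first block of the attacker. -/
def afterPreMine (ω : Path) : Path := residual^[firstAttack ω + 1] ω

lemma measurable_firstAttack : Measurable firstAttack :=
  measurable_sInf_nat fun k =>
    (measurable_bit.comp (measurable_iterate_residual k)) (measurableSet_singleton true)

@[fun_prop]
lemma measurable_afterPreMine : Measurable afterPreMine :=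
  measurable_eval_nat (f := fun n => residual^[n + 1]) measurable_firstAttack
    fun n => measurable_iterate_residual (n + 1)

lemma bit_firstAttack {ω : Path} (h : ∃ n, bit (residual^[n] ω) = true) :
    bit (residual^[firstAttack ω] ω) = true :=
  Nat.sInf_mem (s := {n | bit (residual^[n] ω) = true}) h

lemma count_true_bits_firstAttack (ω : Path) : (bits (firstAttack ω) ω).count true = 0 := by
  rw [List.count_eq_zero, bits, List.mem_map]
  rintro ⟨k, hk, hbit⟩
  exact Nat.notMem_of_lt_sInf (List.mem_range.1 hk) hbit

lemma afterPreMine_eq_ite {ω : Path} (h : ∃ n, bit (residual^[n] ω) = true) :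
    afterPreMine ω = if bit ω = true then residual ω else afterPreMine (residual ω) := by
  split_ifs with hb
  · have h0 : firstAttack ω = 0 := Nat.sInf_eq_zero.2 (Or.inl hb)
    rw [afterPreMine, h0, Function.iterate_one]
  · have h1 : firstAttack ω = firstAttack (residual ω) + 1 := by
      have hpos : 1 ≤ firstAttack ω := by
        by_contra! h0
        rw [Nat.lt_one_iff] at h0
        exact hb (by simpa [h0] using bit_firstAttack h)
      exact (Nat.sInf_add hpos).symm
    rw [afterPreMine, h1, Function.iterate_succ_apply, afterPreMine]

section Law

variable {q τ₀ : ℝ}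

lemma ae_exists_attack (hτ : 0 < τ₀) (hq : 0 < q) (hq1 : q < 1) :
    ∀ᵐ ω ∂law q τ₀, ∃ n, bit (residual^[n] ω) = true := by
  have := isProbabilityMeasure_law hτ hq hq1
  set s : Set Path := {ω | ∀ n, bit (residual^[n] ω) = false} with hs_def
  have hs : MeasurableSet s := by
    simp only [hs_def, Set.ofPred_forall]
    exact MeasurableSet.iInter fun n =>
      (measurable_bit.comp (measurable_iterate_residual n)) (measurableSet_singleton false)
  have step : law q τ₀ s = prob q false * law q τ₀ s + prob q true * 0 := by
    have h := law_bit_residual hτ hq hq1 (s := fun c => if c then ∅ else s)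
      (by rintro (_ | _); exacts [hs, MeasurableSet.empty])
    simp only [Bool.false_eq_true, if_false, if_true, measure_empty] at h
    rw [← h]
    congr 1
    ext ω
    have hiff : ω ∈ s ↔ bit ω = false ∧ residual ω ∈ s :=
      ⟨fun hω => ⟨hω 0, fun n => hω (n + 1)⟩, fun hω => Nat.rec hω.1 fun n _ => hω.2 n⟩
    cases hb : bit ω <;> simp [hiff, hb]
  have := eq_of_eq_prob_mul_add hq hq1 (measure_ne_top _ s) step
  simpa [ae_iff, hs_def] using this

lemma measurePreserving_afterPreMine (hτ : 0 < τ₀) (hq : 0 < q) (hq1 : q < 1) :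
    MeasurePreserving afterPreMine (law q τ₀) (law q τ₀) := by
  have := isProbabilityMeasure_law hτ hq hq1
  refine ⟨measurable_afterPreMine, Measure.ext fun s hs => ?_⟩
  have hpre : MeasurableSet (afterPreMine ⁻¹' s) := measurable_afterPreMine hs
  rw [Measure.map_apply measurable_afterPreMine hs]
  refine eq_of_eq_prob_mul_add hq hq1 (measure_ne_top _ _) ?_
  refine Eq.trans ?_ (law_bit_residual hτ hq hq1
    (s := fun c => if c then s else afterPreMine ⁻¹' s)
    (by rintro (_ | _); exacts [hpre, hs]))
  refine measure_congr (eventuallyEq_set.2 ((ae_exists_attack hτ hq hq1).mono fun ω hω => ?_))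
  cases hb : bit ω <;> simp [afterPreMine_eq_ite hω, hb]

end Law

/-! ### Block counts along a path -/

lemma blockCount_eq {x : ℕ → ℝ} (hx : ∀ k, 0 < x k) {m : ℕ} {t : ℝ}
    (h1 : ∑ k ∈ Finset.range m, x k ≤ t) (h2 : t < ∑ k ∈ Finset.range (m + 1), x k) :
    blockCount x t = m := by
  have hmono : StrictMono fun n => ∑ k ∈ Finset.range n, x k :=
    strictMono_nat_of_lt_succ fun n => by
      rw [Finset.sum_range_succ]; exact lt_add_of_pos_right _ (hx n)
  have hiff (n : ℕ) : ∑ k ∈ Finset.range n, x k ≤ t ↔ n ≤ m :=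
    ⟨fun h => Nat.lt_succ_iff.1 (hmono.lt_iff_lt.1 (h.trans_lt h2)),
      fun h => (hmono.monotone h).trans h1⟩
  have hset : {n : ℕ | 1 ≤ n ∧ ∑ k ∈ Finset.range n, x k ≤ t} = (Finset.Icc 1 m : Finset ℕ) := by
    ext n; simp [hiff]
  rw [blockCount, hset, Set.ncard_coe_finset, Nat.card_Icc, Nat.add_sub_cancel]

/-- The waiting times of the attacker (`true`) or of the honest miners (`false`). -/
def clock : Bool → Path → ℕ → ℝ
  | true, ω => ω.2
  | false, ω => ω.1

/-- The time at which the `n`-th block is found. -/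
def time (n : ℕ) (ω : Path) : ℝ := ∑ i ∈ Finset.range n, wait (residual^[i] ω)

/-- The generic paths: all waiting times are positive and the attacker keeps finding blocks. -/
structure Regular (ω : Path) : Prop where
  clock_pos : ∀ n c k, 0 < clock c (residual^[n] ω) k
  exists_attack : ∃ n, bit (residual^[n] ω) = true

@[simp] lemma time_zero (ω : Path) : time 0 ω = 0 := rfl

lemma time_succ (n : ℕ) (ω : Path) : time (n + 1) ω = time n ω + wait (residual^[n] ω) :=
  Finset.sum_range_succ _ _

lemma time_succ' (n : ℕ) (ω : Path) : time (n + 1) ω = wait ω + time n (residual ω) := by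
  simp only [time, Finset.sum_range_succ' _ n, Function.iterate_succ_apply, add_comm,
    Function.iterate_zero_apply]

lemma time_add (m n : ℕ) (ω : Path) : time (m + n) ω = time m ω + time n (residual^[m] ω) := by
  simp only [time, Finset.sum_range_add, ← Function.iterate_add_apply, Nat.add_comm _ m]

@[fun_prop]
lemma measurable_time (n : ℕ) : Measurable (time n) :=
  Finset.measurable_sum _ fun i _ => measurable_wait.comp (measurable_iterate_residual i)

lemma wait_le_clock (c : Bool) (ω : Path) : wait ω ≤ clock c ω 0 := by
  cases c
  exacts [min_le_left _ _, min_le_right _ _]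

lemma wait_eq_clock_bit (ω : Path) : wait ω = clock (bit ω) ω 0 := by
  by_cases h : ω.2 0 ≤ ω.1 0
  · simp [wait, bit, h, clock]
  · simp [wait, bit, h, clock, (not_le.1 h).le]

lemma wait_add_sum_clock (c : Bool) (k : ℕ) (ω : Path) :
    wait ω + ∑ i ∈ Finset.range (k + 1), clock c (residual ω) i
      = ∑ i ∈ Finset.range ((k + 1) + if bit ω == c then 1 else 0), clock c ω i := by
  by_cases h : ω.2 0 ≤ ω.1 0 <;> cases c <;>
    simp [wait, bit, h, clock, residual, Finset.sum_range_succ', (not_le.1 _).le] <;> ring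

lemma time_add_sum_clock (c : Bool) (n k : ℕ) (ω : Path) :
    time n ω + ∑ i ∈ Finset.range (k + 1), clock c (residual^[n] ω) i
      = ∑ i ∈ Finset.range ((k + 1) + (bits n ω).count c), clock c ω i := by
  induction n generalizing ω with
  | zero => simp
  | succ n ih =>
    rw [time_succ', Function.iterate_succ_apply, add_assoc, ih, bits_succ, List.count_cons,
      ← add_assoc, show k + 1 + (bits n (residual ω)).count c
        = k + (bits n (residual ω)).count c + 1 by ring, wait_add_sum_clock]

lemma time_add_clock (c : Bool) (n : ℕ) (ω : Path) :
    time n ω + clock c (residual^[n] ω) 0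
      = ∑ i ∈ Finset.range ((bits n ω).count c + 1), clock c ω i := by
  simpa [add_comm 1] using time_add_sum_clock c n 0 ω

namespace Regular

variable {ω : Path} {n : ℕ} {t : ℝ}

lemma wait_pos (h : Regular ω) (n : ℕ) : 0 < wait (residual^[n] ω) :=
  lt_min (h.clock_pos n false 0) (h.clock_pos n true 0)

lemma time_strictMono (h : Regular ω) : StrictMono fun n => time n ω :=
  strictMono_nat_of_lt_succ fun n => by
    rw [time_succ]; exact lt_add_of_pos_right _ (h.wait_pos n)

lemma sum_clock_le_time (h : Regular ω) (c : Bool) (n : ℕ) :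
    ∑ i ∈ Finset.range ((bits n ω).count c), clock c ω i ≤ time n ω := by
  induction n with
  | zero => simp
  | succ n ih =>
    rw [bits_succ', List.count_append, List.count_singleton]
    split_ifs with hbit
    · rw [← time_add_clock, time_succ, wait_eq_clock_bit, eq_of_beq hbit]
    · exact ih.trans (h.time_strictMono.monotone n.le_succ)

lemma blockCount_eq_count (h : Regular ω) (c : Bool) (h1 : time n ω ≤ t)
    (h2 : t < time (n + 1) ω) : blockCount (clock c ω) t = (bits n ω).count c := by
  have hnext : time (n + 1) ω ≤ ∑ k ∈ Finset.range ((bits n ω).count c + 1), clock c ω k := by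
    rw [← time_add_clock, time_succ]
    gcongr
    exact wait_le_clock c _
  exact blockCount_eq (h.clock_pos 0 c) ((h.sum_clock_le_time c n).trans h1) (h2.trans_le hnext)

lemma preMineTime_eq (h : Regular ω) : preMineTime ω = time (firstAttack ω + 1) ω := by
  rw [time_succ, wait_eq_clock_bit, bit_firstAttack h.exists_attack, time_add_clock,
    count_true_bits_firstAttack, Finset.sum_range_one]
  rfl

lemma preMineTime_add_time (h : Regular ω) (n : ℕ) :
    preMineTime ω + time n (afterPreMine ω) = time (firstAttack ω + 1 + n) ω := by
  rw [time_add _ n, h.preMineTime_eq, afterPreMine]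

lemma secretBlocks_eq (h : Regular ω) (h1 : preMineTime ω + time n (afterPreMine ω) ≤ t)
    (h2 : t < preMineTime ω + time (n + 1) (afterPreMine ω)) :
    secretBlocks ω t = 1 + (bits n (afterPreMine ω)).count true := by
  rw [h.preMineTime_add_time] at h1 h2
  have hcount : (bits (firstAttack ω + 1) ω).count true = 1 := by
    simp [bits_succ', count_true_bits_firstAttack, bit_firstAttack h.exists_attack]
  rw [secretBlocks, ← hcount, afterPreMine, ← List.count_append, ← bits_add]
  exact h.blockCount_eq_count true h1 h2

lemma officialBlocks_eq (h : Regular ω) (h1 : preMineTime ω + time n (afterPreMine ω) ≤ t)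
    (h2 : t < preMineTime ω + time (n + 1) (afterPreMine ω)) :
    officialBlocks ω t = (bits n (afterPreMine ω)).count false := by
  have hmine : blockCount ω.1 (preMineTime ω) = (bits (firstAttack ω + 1) ω).count false :=
    h.blockCount_eq_count false h.preMineTime_eq.ge
      (h.preMineTime_eq.trans_lt (h.time_strictMono (Nat.lt_succ_self _)))
  rw [h.preMineTime_add_time] at h1 h2
  have htotal : blockCount ω.1 t = (bits (firstAttack ω + 1 + n) ω).count false :=
    h.blockCount_eq_count false h1 h2
  rw [officialBlocks, htotal, hmine, bits_add, List.count_append, Nat.add_sub_cancel_left,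
    afterPreMine]

end Regular

/-! ### The attack as a function of the sequence of miners -/

/-- The double spend succeeds when the miners of the blocks since the pre-mining phase are `l`;
the secret fork has one more block than those of the attacker in `l`. -/
def ListSucceeds (z : ℕ) (l : List Bool) : Prop :=
  z ≤ l.count false ∧ l.count false < 1 + l.count true

/-- There is a reason to end the attack when the miners of the blocks since the pre-mining phase
are `l`. -/
def ListEnds (z A : ℕ) (l : List Bool) : Prop :=
  ListSucceeds z l ∨ 1 + l.count true + A ≤ l.count false

/-- The number of blocks found between the pre-mining phase and the end of the attack, as a
function of the waiting times after the pre-mining phase. -/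
def endIndex (z A : ℕ) (η : Path) : ℕ := sInf {n | ListEnds z A (bits n η)}

open scoped Classical in
/-- The revenue of an attack that ends when the miners of the blocks since the pre-mining phase
are `l`. -/
def listRevenue (b v : ℝ) (z : ℕ) (l : List Bool) : ℝ :=
  if ListSucceeds z l then v + b * (1 + l.count true : ℕ) else 0

lemma listEnds_endIndex {z A : ℕ} {η : Path} (h : ∃ n, ListEnds z A (bits n η)) :
    ListEnds z A (bits (endIndex z A η) η) :=
  Nat.sInf_mem (s := {n | ListEnds z A (bits n η)}) h

lemma exists_time_le_lt {ω : Path} {t : ℝ} {N : ℕ} (h0 : 0 ≤ t) (hN : t < time N ω) :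
    ∃ n < N, time n ω ≤ t ∧ t < time (n + 1) ω := by
  induction N with
  | zero => exact absurd h0 (not_le.2 hN)
  | succ N ih =>
    rcases lt_or_ge t (time N ω) with h | h
    · obtain ⟨n, hn, hmem⟩ := ih h
      exact ⟨n, hn.trans N.lt_succ_self, hmem⟩
    · exact ⟨N, N.lt_succ_self, h, hN⟩

namespace Regular

variable {z A : ℕ} {ω : Path} {n : ℕ} {t : ℝ}

lemma time_afterPreMine_strictMono (h : Regular ω) :
    StrictMono fun n => preMineTime ω + time n (afterPreMine ω) := by
  simp only [h.preMineTime_add_time]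
  exact h.time_strictMono.comp fun _ _ hmn => Nat.add_lt_add_left hmn _

lemma succeeds_iff (h : Regular ω) (h1 : preMineTime ω + time n (afterPreMine ω) ≤ t)
    (h2 : t < preMineTime ω + time (n + 1) (afterPreMine ω)) :
    Succeeds z ω t ↔ ListSucceeds z (bits n (afterPreMine ω)) := by
  rw [Succeeds, ListSucceeds, h.officialBlocks_eq h1 h2, h.secretBlocks_eq h1 h2]

lemma succeeds_or_givesUp_iff (h : Regular ω)
    (h1 : preMineTime ω + time n (afterPreMine ω) ≤ t)
    (h2 : t < preMineTime ω + time (n + 1) (afterPreMine ω)) :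
    Succeeds z ω t ∨ GivesUp A ω t ↔ ListEnds z A (bits n (afterPreMine ω)) := by
  rw [h.succeeds_iff h1 h2, GivesUp, ListEnds, h.officialBlocks_eq h1 h2, h.secretBlocks_eq h1 h2]

lemma isLeast_endTimes (h : Regular ω) (hend : ∃ n, ListEnds z A (bits n (afterPreMine ω))) :
    IsLeast (endTimes z A ω)
      (preMineTime ω + time (endIndex z A (afterPreMine ω)) (afterPreMine ω)) := by
  have hmono := h.time_afterPreMine_strictMono
  refine ⟨⟨?_, ?_⟩, ?_⟩
  · simpa using hmono.monotone (Nat.zero_le (endIndex z A (afterPreMine ω)))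
  · exact (h.succeeds_or_givesUp_iff le_rfl (hmono (Nat.lt_succ_self _))).2
      (listEnds_endIndex hend)
  · rintro t ⟨hpre, ht⟩
    by_contra! hlt
    obtain ⟨n, hn, h1, h2⟩ := exists_time_le_lt (sub_nonneg.2 hpre) (sub_lt_iff_lt_add'.2 hlt)
    rw [le_sub_iff_add_le'] at h1
    rw [sub_lt_iff_lt_add'] at h2
    exact hn.not_ge (Nat.sInf_le ((h.succeeds_or_givesUp_iff h1 h2).1 ht))

lemma duration_eq (h : Regular ω) (hend : ∃ n, ListEnds z A (bits n (afterPreMine ω))) :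
    duration z A ω
      = preMineTime ω + time (endIndex z A (afterPreMine ω)) (afterPreMine ω) :=
  (h.isLeast_endTimes hend).csInf_eq

lemma revenue_eq (h : Regular ω) (hend : ∃ n, ListEnds z A (bits n (afterPreMine ω))) (b v : ℝ) :
    revenue b v z A ω
      = listRevenue b v z (bits (endIndex z A (afterPreMine ω)) (afterPreMine ω)) := by
  have h1 := (h.duration_eq hend).ge
  have h2 : duration z A ω
      < preMineTime ω + time (endIndex z A (afterPreMine ω) + 1) (afterPreMine ω) :=
    (h.duration_eq hend).trans_lt (h.time_afterPreMine_strictMono (Nat.lt_succ_self _))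
  classical
  rw [revenue, listRevenue, h.secretBlocks_eq h1 h2]
  exact if_congr (h.succeeds_iff h1 h2) rfl rfl

end Regular

/-! ### The duration of the attack -/

/-- There has been no reason to end the attack while the miners of the blocks since the pre-mining
phase were those of `l`. -/
def Running (z A : ℕ) (l : List Bool) : Prop := ∀ k ≤ l.length, ¬ListEnds z A (l.take k)

lemma take_bits {k n : ℕ} (h : k ≤ n) (ω : Path) : (bits n ω).take k = bits k ω := by
  simp [bits, ← List.map_take, List.take_range, min_eq_left h]

lemma running_bits_iff {z A n : ℕ} {η : Path} :
    Running z A (bits n η) ↔ ∀ k ≤ n, ¬ListEnds z A (bits k η) := by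
  simp only [Running, length_bits]
  exact forall₂_congr fun k hk => by rw [take_bits hk]

lemma running_bits_iff_lt {z A n : ℕ} {η : Path} (h : ∃ n, ListEnds z A (bits n η)) :
    Running z A (bits n η) ↔ n < endIndex z A η := by
  rw [running_bits_iff]
  refine ⟨fun hr => ?_, fun hn k hk => Nat.notMem_of_lt_sInf (hk.trans_lt hn)⟩
  by_contra! hn
  exact hr _ hn (listEnds_endIndex h)

lemma Running.not_listEnds {z A : ℕ} {l : List Bool} (h : Running z A l) : ¬ListEnds z A l := by
  simpa using h l.length le_rfl

lemma Running.of_append {z A : ℕ} {l l' : List Bool} (h : Running z A (l ++ l')) :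
    Running z A l := fun k hk => by
  simpa [List.take_append_of_le_length hk] using h k (by simpa using hk.trans le_self_add)

open scoped Classical in
/-- The distance from giving up, while the attack is running. Its drift is at most `2 * q - 1`,
which bounds the expected number of blocks of the attack. -/
def margin (z A : ℕ) (l : List Bool) : ℕ :=
  if Running z A l then A + 1 + l.count true - l.count false else 0

lemma margin_append_false_add_one_le {z A : ℕ} {l : List Bool} (h : Running z A l) :
    margin z A (l ++ [false]) + 1 ≤ margin z A l := by
  have hlag := h.not_listEnds
  simp only [ListEnds, not_or, not_le] at hlag
  simp only [margin, h, if_true, List.count_append, List.count_singleton]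
  split_ifs <;> simp_all <;> lia

lemma margin_append_true_le {z A : ℕ} {l : List Bool} (h : Running z A l) :
    margin z A (l ++ [true]) ≤ margin z A l + 1 := by
  simp only [margin, h, if_true, List.count_append, List.count_singleton]
  split_ifs <;> simp_all
  lia

lemma margin_append_eq_zero {z A : ℕ} {l : List Bool} (h : ¬Running z A l) (l' : List Bool) :
    margin z A (l ++ l') = 0 :=
  if_neg fun h' => h h'.of_append

section Law

variable {q τ₀ : ℝ}

lemma lintegral_margin_succ_add_le (hτ : 0 < τ₀) (hq : 0 < q) (hq1 : q < 1) (z A n : ℕ) :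
    ∫⁻ ω, margin z A (bits (n + 1) ω) ∂law q τ₀
        + prob q false * law q τ₀ {ω | Running z A (bits n ω)}
      ≤ ∫⁻ ω, margin z A (bits n ω) ∂law q τ₀
        + prob q true * law q τ₀ {ω | Running z A (bits n ω)} := by
  set R : Set Path := {ω | Running z A (bits n ω)}
  have hR : MeasurableSet R := measurableSet_bits _ n
  have honest : ∫⁻ ω, (margin z A (bits n ω ++ [false]) : ℝ≥0∞) ∂law q τ₀ + law q τ₀ R
      ≤ ∫⁻ ω, margin z A (bits n ω) ∂law q τ₀ := by
    rw [← lintegral_indicator_one hR, ← lintegral_add_right _ (measurable_one.indicator hR)]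
    refine lintegral_mono fun ω => ?_
    by_cases h : Running z A (bits n ω)
    · simpa [R, h] using mod_cast margin_append_false_add_one_le h
    · simp [R, h, margin_append_eq_zero h]
  have attacker : ∫⁻ ω, (margin z A (bits n ω ++ [true]) : ℝ≥0∞) ∂law q τ₀
      ≤ ∫⁻ ω, margin z A (bits n ω) ∂law q τ₀ + law q τ₀ R := by
    rw [← lintegral_indicator_one hR, ← lintegral_add_right _ (measurable_one.indicator hR)]
    refine lintegral_mono fun ω => ?_
    by_cases h : Running z A (bits n ω)
    · simpa [R, h] using mod_cast margin_append_true_le h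
    · simp [R, h, margin_append_eq_zero h]
  rw [lintegral_bits_succ' hτ hq hq1 n fun l => (margin z A l : ℝ≥0∞), add_right_comm, ← mul_add]
  calc _ ≤ prob q false * ∫⁻ ω, margin z A (bits n ω) ∂law q τ₀
        + prob q true * (∫⁻ ω, margin z A (bits n ω) ∂law q τ₀ + law q τ₀ R) := by gcongr
    _ = _ := by rw [mul_add, ← add_assoc, ← add_mul, prob_add hq hq1, one_mul]

lemma prob_false_mul_sum_running_le (hτ : 0 < τ₀) (hq : 0 < q) (hq1 : q < 1) (z A n : ℕ) :
    prob q false * ∑ k ∈ Finset.range n, law q τ₀ {ω | Running z A (bits k ω)}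
      ≤ (A + 1 : ℕ)
        + prob q true * ∑ k ∈ Finset.range n, law q τ₀ {ω | Running z A (bits k ω)} := by
  suffices h : ∫⁻ ω, margin z A (bits n ω) ∂law q τ₀
      + prob q false * ∑ k ∈ Finset.range n, law q τ₀ {ω | Running z A (bits k ω)}
      ≤ (A + 1 : ℕ) + prob q true * ∑ k ∈ Finset.range n, law q τ₀ {ω | Running z A (bits k ω)} from
    le_add_self.trans h
  induction n with
  | zero =>
    have := isProbabilityMeasure_law hτ hq hq1
    have hmargin : margin z A [] ≤ A + 1 := by unfold margin; split_ifs <;> simp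
    simpa using mod_cast hmargin
  | succ n ih =>
    simp only [Finset.sum_range_succ, mul_add]
    calc _ = (∫⁻ ω, margin z A (bits (n + 1) ω) ∂law q τ₀
            + prob q false * law q τ₀ {ω | Running z A (bits n ω)})
          + prob q false * ∑ k ∈ Finset.range n, law q τ₀ {ω | Running z A (bits k ω)} := by ring
      _ ≤ (∫⁻ ω, margin z A (bits n ω) ∂law q τ₀
            + prob q true * law q τ₀ {ω | Running z A (bits n ω)})
          + prob q false * ∑ k ∈ Finset.range n, law q τ₀ {ω | Running z A (bits k ω)} := by
        gcongr ?_ + _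
        exact lintegral_margin_succ_add_le hτ hq hq1 z A n
      _ = (∫⁻ ω, margin z A (bits n ω) ∂law q τ₀
            + prob q false * ∑ k ∈ Finset.range n, law q τ₀ {ω | Running z A (bits k ω)})
          + prob q true * law q τ₀ {ω | Running z A (bits n ω)} := by ring
      _ ≤ _ := by
        rw [← add_assoc]
        gcongr

lemma tsum_running_le (hτ : 0 < τ₀) (hq : 0 < q) (hq2 : q < 1 / 2) (z A : ℕ) :
    ∑' n, law q τ₀ {ω | Running z A (bits n ω)} ≤ ENNReal.ofReal ((A + 1) / (1 - 2 * q)) := by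
  have hq1 : q < 1 := by linarith
  have := isProbabilityMeasure_law hτ hq hq1
  refine ENNReal.tsum_le_of_sum_range_le fun n => ?_
  have hfin : ∑ k ∈ Finset.range n, law q τ₀ {ω | Running z A (bits k ω)} ≠ ∞ :=
    ENNReal.sum_ne_top.2 fun k _ => measure_ne_top _ _
  have h := prob_false_mul_sum_running_le hτ hq hq1 z A n
  rw [← ENNReal.ofReal_toReal hfin] at h ⊢
  set S := (∑ k ∈ Finset.range n, law q τ₀ {ω | Running z A (bits k ω)}).toReal
  have hS : 0 ≤ S := ENNReal.toReal_nonneg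
  simp only [prob, Bool.false_eq_true, if_false, if_true] at h
  rw [← ENNReal.ofReal_mul (by linarith), ← ENNReal.ofReal_mul hq.le, ← ENNReal.ofReal_natCast,
    ← ENNReal.ofReal_add (Nat.cast_nonneg _) (mul_nonneg hq.le hS),
    ENNReal.ofReal_le_ofReal_iff (by positivity)] at h
  push_cast at h
  refine ENNReal.ofReal_le_ofReal ?_
  rw [le_div_iff₀ (by linarith)]
  linarith

lemma ae_exists_listEnds (hτ : 0 < τ₀) (hq : 0 < q) (hq2 : q < 1 / 2) (z A : ℕ) :
    ∀ᵐ η ∂law q τ₀, ∃ n, ListEnds z A (bits n η) := by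
  have hsum := ne_top_of_le_ne_top ENNReal.ofReal_ne_top (tsum_running_le hτ hq hq2 z A)
  filter_upwards [ae_eventually_notMem hsum] with η hη
  obtain ⟨n, hn⟩ := hη.exists
  rw [running_bits_iff] at hn
  push Not at hn
  obtain ⟨k, -, hk⟩ := hn
  exact ⟨k, hk⟩

lemma ae_exists_listEnds_afterPreMine (hτ : 0 < τ₀) (hq : 0 < q) (hq2 : q < 1 / 2) (z A : ℕ) :
    ∀ᵐ ω ∂law q τ₀, ∃ n, ListEnds z A (bits n (afterPreMine ω)) :=
  (measurePreserving_afterPreMine hτ hq (by linarith)).quasiMeasurePreserving.ae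
    (ae_exists_listEnds hτ hq hq2 z A)

lemma ae_clock_pos (hτ : 0 < τ₀) (hq : 0 < q) (hq1 : q < 1) (c : Bool) (k : ℕ) :
    ∀ᵐ ω ∂law q τ₀, 0 < clock c ω k := by
  have := isProbabilityMeasure_expMeasure (r := (1 - q) / τ₀) (div_pos (by linarith) hτ)
  have := isProbabilityMeasure_expMeasure (r := q / τ₀) (div_pos hq hτ)
  cases c
  · exact ((measurePreserving_eval_infinitePi (fun _ : ℕ => expMeasure ((1 - q) / τ₀)) k).comp
      measurePreserving_fst).quasiMeasurePreserving.ae (ae_pos_expMeasure _)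
  · exact ((measurePreserving_eval_infinitePi (fun _ : ℕ => expMeasure (q / τ₀)) k).comp
      measurePreserving_snd).quasiMeasurePreserving.ae (ae_pos_expMeasure _)

lemma ae_regular (hτ : 0 < τ₀) (hq : 0 < q) (hq1 : q < 1) : ∀ᵐ ω ∂law q τ₀, Regular ω := by
  have hpos (n : ℕ) : ∀ᵐ ω ∂law q τ₀, ∀ c k, 0 < clock c (residual^[n] ω) k :=
    ((measurePreserving_residual hτ hq hq1).iterate n).quasiMeasurePreserving.ae
      (ae_all_iff.2 fun c => ae_all_iff.2 fun k => ae_clock_pos hτ hq hq1 c k)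
  filter_upwards [ae_all_iff.2 hpos, ae_exists_attack hτ hq hq1] with ω h1 h2
  exact ⟨h1, h2⟩

lemma ae_nonempty_endTimes (hτ : 0 < τ₀) (hq : 0 < q) (hq2 : q < 1 / 2) (z A : ℕ) :
    ∀ᵐ ω ∂law q τ₀, (endTimes z A ω).Nonempty := by
  filter_upwards [ae_regular hτ hq (by linarith),
    ae_exists_listEnds_afterPreMine hτ hq hq2 z A] with ω h1 h2
  exact ⟨_, (h1.isLeast_endTimes h2).1⟩

lemma lintegral_clock_zero (hτ : 0 < τ₀) (hq : 0 < q) (hq1 : q < 1) (c : Bool) :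
    ∫⁻ ω, ENNReal.ofReal (clock c ω 0) ∂law q τ₀
      = ENNReal.ofReal (τ₀ / if c then q else 1 - q) := by
  have := isProbabilityMeasure_law hτ hq hq1
  cases c
  · rw [lintegral_law_eq_seqCons_fst hτ hq hq1 (by simp only [clock]; fun_prop)]
    simpa [clock] using lintegral_id_expMeasure (r := (1 - q) / τ₀) (div_pos (by linarith) hτ)
  · rw [lintegral_law_eq_seqCons_snd hτ hq hq1 (by simp only [clock]; fun_prop)]
    simpa [clock] using lintegral_id_expMeasure (r := q / τ₀) (div_pos hq hτ)

end Law

lemma measurable_endIndex (z A : ℕ) : Measurable (endIndex z A) :=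
  measurable_sInf_nat fun k => measurableSet_bits _ k

/-- The time from the pre-mining phase to the end of the attack, as a function of the waiting times
after the pre-mining phase. -/
def attackTime (z A : ℕ) (η : Path) : ℝ := time (endIndex z A η) η

@[fun_prop]
lemma measurable_attackTime (z A : ℕ) : Measurable (attackTime z A) :=
  measurable_eval_nat (measurable_endIndex z A) measurable_time

lemma Regular.attackTime_nonneg {η : Path} (h : Regular η) (z A : ℕ) : 0 ≤ attackTime z A η := by
  rw [attackTime, time]
  exact Finset.sum_nonneg fun i _ => (h.wait_pos i).le

section Law

variable {q τ₀ : ℝ}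

lemma setLIntegral_running (hτ : 0 < τ₀) (hq : 0 < q) (hq1 : q < 1) (z A n : ℕ)
    {g : Path → ℝ≥0∞} (hg : Measurable g) :
    ∫⁻ ω in {ω | Running z A (bits n ω)}, g (residual^[n] ω) ∂law q τ₀
      = law q τ₀ {ω | Running z A (bits n ω)} * ∫⁻ ω, g ω ∂law q τ₀ := by
  have hR : MeasurableSet {ω | Running z A (bits n ω)} := measurableSet_bits _ n
  have h := lintegral_bits_mul hτ hq hq1 n (Set.indicator {l | Running z A l} 1) hg
  rw [← lintegral_indicator_one hR, ← lintegral_indicator hR]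
  convert h using 3 with ω
  · by_cases hω : Running z A (bits n ω) <;> simp [hω]
  · ext ω
    by_cases hω : Running z A (bits n ω) <;> simp [hω]

/-- Wald's identity: whether the attack goes on after `n` blocks depends only on the miners of these
blocks, which are independent of the waiting times that remain. -/
lemma lintegral_sum_range_endIndex (hτ : 0 < τ₀) (hq : 0 < q) (hq2 : q < 1 / 2) (z A : ℕ)
    {g : Path → ℝ≥0∞} (hg : Measurable g) :
    ∫⁻ η, ∑ n ∈ Finset.range (endIndex z A η), g (residual^[n] η) ∂law q τ₀
      = (∑' n, law q τ₀ {ω | Running z A (bits n ω)}) * ∫⁻ ω, g ω ∂law q τ₀ := by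
  have hR (n : ℕ) : MeasurableSet {ω | Running z A (bits n ω)} := measurableSet_bits _ n
  have hsum : ∀ᵐ η ∂law q τ₀, ∑ n ∈ Finset.range (endIndex z A η), g (residual^[n] η)
      = ∑' n, {η | Running z A (bits n η)}.indicator (fun η => g (residual^[n] η)) η := by
    filter_upwards [ae_exists_listEnds hτ hq hq2 z A] with η hend
    simp only [Set.indicator, Set.mem_ofPred_eq, running_bits_iff_lt hend]
    rw [tsum_eq_sum (s := Finset.range (endIndex z A η)) fun n hn => by simp_all]
    exact Finset.sum_congr rfl fun n hn => (if_pos (Finset.mem_range.1 hn)).symm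
  rw [lintegral_congr_ae hsum, ← ENNReal.tsum_mul_right,
    lintegral_tsum fun n => (Measurable.indicator (by fun_prop) (hR n)).aemeasurable]
  refine tsum_congr fun n => ?_
  rw [lintegral_indicator (hR n), setLIntegral_running hτ hq (by linarith) z A n hg]

lemma lintegral_attackTime_le (hτ : 0 < τ₀) (hq : 0 < q) (hq2 : q < 1 / 2) (z A : ℕ) :
    ∫⁻ η, ENNReal.ofReal (attackTime z A η) ∂law q τ₀
      ≤ ENNReal.ofReal ((A + 1) / (1 - 2 * q) * (τ₀ / (1 - q))) := by
  have hq1 : q < 1 := by linarith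
  have hwait : ∫⁻ ω, ENNReal.ofReal (wait ω) ∂law q τ₀ ≤ ENNReal.ofReal (τ₀ / (1 - q)) := by
    refine (lintegral_mono fun ω => ?_).trans (lintegral_clock_zero hτ hq hq1 false).le
    exact ENNReal.ofReal_le_ofReal (wait_le_clock false ω)
  have hsum : ∀ᵐ η ∂law q τ₀, ENNReal.ofReal (attackTime z A η)
      = ∑ n ∈ Finset.range (endIndex z A η), ENNReal.ofReal (wait (residual^[n] η)) :=
    (ae_regular hτ hq hq1).mono fun η h => by
      rw [attackTime, time]
      exact ENNReal.ofReal_sum_of_nonneg fun n _ => (h.wait_pos n).le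
  rw [lintegral_congr_ae hsum, ENNReal.ofReal_mul (div_nonneg (by positivity) (by linarith)),
    lintegral_sum_range_endIndex hτ hq hq2 z A (g := fun ω => ENNReal.ofReal (wait ω))
      (by fun_prop)]
  gcongr
  exact tsum_running_le hτ hq hq2 z A

lemma duration_ae_eq (hτ : 0 < τ₀) (hq : 0 < q) (hq2 : q < 1 / 2) (z A : ℕ) :
    duration z A =ᵐ[law q τ₀] fun ω => preMineTime ω + attackTime z A (afterPreMine ω) := by
  filter_upwards [ae_regular hτ hq (by linarith),
    ae_exists_listEnds_afterPreMine hτ hq hq2 z A] with ω h1 h2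
  exact h1.duration_eq h2

lemma aestronglyMeasurable_duration (hτ : 0 < τ₀) (hq : 0 < q) (hq2 : q < 1 / 2) (z A : ℕ) :
    AEStronglyMeasurable (duration z A) (law q τ₀) := by
  have h : Measurable fun ω => preMineTime ω + attackTime z A (afterPreMine ω) := by
    unfold preMineTime
    fun_prop
  exact h.aestronglyMeasurable.congr (duration_ae_eq hτ hq hq2 z A).symm

lemma ae_nonneg_attackTime_afterPreMine (hτ : 0 < τ₀) (hq : 0 < q) (hq1 : q < 1) (z A : ℕ) :
    ∀ᵐ ω ∂law q τ₀, 0 ≤ attackTime z A (afterPreMine ω) :=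
  (measurePreserving_afterPreMine hτ hq hq1).quasiMeasurePreserving.ae
    ((ae_regular hτ hq hq1).mono fun _ h => h.attackTime_nonneg z A)

lemma ae_nonneg_duration (hτ : 0 < τ₀) (hq : 0 < q) (hq2 : q < 1 / 2) (z A : ℕ) :
    0 ≤ᵐ[law q τ₀] duration z A := by
  have hq1 : q < 1 := by linarith
  filter_upwards [duration_ae_eq hτ hq hq2 z A, ae_clock_pos hτ hq hq1 true 0,
    ae_nonneg_attackTime_afterPreMine hτ hq hq1 z A] with ω h1 h2 h3
  rw [h1]
  exact add_nonneg h2.le h3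

lemma lintegral_duration (hτ : 0 < τ₀) (hq : 0 < q) (hq2 : q < 1 / 2) (z A : ℕ) :
    ∫⁻ ω, ENNReal.ofReal (duration z A ω) ∂law q τ₀
      = ENNReal.ofReal (τ₀ / q) + ∫⁻ η, ENNReal.ofReal (attackTime z A η) ∂law q τ₀ := by
  have hq1 : q < 1 := by linarith
  have hattack : Measurable fun η => ENNReal.ofReal (attackTime z A η) := by fun_prop
  calc ∫⁻ ω, ENNReal.ofReal (duration z A ω) ∂law q τ₀
      = ∫⁻ ω, (ENNReal.ofReal (clock true ω 0)
          + ENNReal.ofReal (attackTime z A (afterPreMine ω))) ∂law q τ₀ := by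
        refine lintegral_congr_ae ?_
        filter_upwards [duration_ae_eq hτ hq hq2 z A, ae_clock_pos hτ hq hq1 true 0,
          ae_nonneg_attackTime_afterPreMine hτ hq hq1 z A] with ω h1 h2 h3
        rw [h1]
        exact ENNReal.ofReal_add h2.le h3
    _ = _ := by
        rw [lintegral_add_right _ (by fun_prop), lintegral_clock_zero hτ hq hq1,
          (measurePreserving_afterPreMine hτ hq hq1).lintegral_comp hattack, if_pos rfl]

lemma lintegral_duration_le (hτ : 0 < τ₀) (hq : 0 < q) (hq2 : q < 1 / 2) (z A : ℕ) :
    ∫⁻ ω, ENNReal.ofReal (duration z A ω) ∂law q τ₀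
      ≤ ENNReal.ofReal (τ₀ / q + (A + 1) / (1 - 2 * q) * (τ₀ / (1 - q))) := by
  have hattack : 0 ≤ (A + 1) / (1 - 2 * q) * (τ₀ / (1 - q)) :=
    mul_nonneg (div_nonneg (by positivity) (by linarith)) (div_nonneg hτ.le (by linarith))
  rw [lintegral_duration hτ hq hq2, ENNReal.ofReal_add (by positivity) hattack]
  gcongr
  exact lintegral_attackTime_le hτ hq hq2 z A

lemma integrable_duration (hτ : 0 < τ₀) (hq : 0 < q) (hq2 : q < 1 / 2) (z A : ℕ) :
    Integrable (duration z A) (law q τ₀) := by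
  refine ⟨aestronglyMeasurable_duration hτ hq hq2 z A, ?_⟩
  rw [hasFiniteIntegral_iff_ofReal (ae_nonneg_duration hτ hq hq2 z A)]
  exact (lintegral_duration_le hτ hq hq2 z A).trans_lt ENNReal.ofReal_lt_top

lemma le_integral_duration (hτ : 0 < τ₀) (hq : 0 < q) (hq2 : q < 1 / 2) (z A : ℕ) :
    τ₀ / q ≤ ∫ ω, duration z A ω ∂law q τ₀ := by
  rw [← ENNReal.ofReal_le_ofReal_iff
      (integral_nonneg_of_ae (ae_nonneg_duration hτ hq hq2 z A)),
    ofReal_integral_eq_lintegral_ofReal (integrable_duration hτ hq hq2 z A)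
      (ae_nonneg_duration hτ hq hq2 z A), lintegral_duration hτ hq hq2]
  exact le_self_add

lemma integral_duration_le (hτ : 0 < τ₀) (hq : 0 < q) (hq2 : q < 1 / 2) (z A : ℕ) :
    ∫ ω, duration z A ω ∂law q τ₀ ≤ τ₀ / q + (A + 1) / (1 - 2 * q) * (τ₀ / (1 - q)) := by
  rw [integral_eq_lintegral_of_nonneg_ae (ae_nonneg_duration hτ hq hq2 z A)
    (aestronglyMeasurable_duration hτ hq hq2 z A)]
  refine ENNReal.toReal_le_of_le_ofReal (add_nonneg (by positivity) ?_)
    (lintegral_duration_le hτ hq hq2 z A)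
  exact mul_nonneg (div_nonneg (by positivity) (by linarith)) (div_nonneg hτ.le (by linarith))

lemma integral_duration_pos (hτ : 0 < τ₀) (hq : 0 < q) (hq2 : q < 1 / 2) (z A : ℕ) :
    0 < ∫ ω, duration z A ω ∂law q τ₀ :=
  (div_pos hτ hq).trans_le (le_integral_duration hτ hq hq2 z A)

end Law

/-! ### The revenue of the attack -/

/-- The revenue of the attack, as a function of the waiting times after the pre-mining phase. -/
def reward (b v : ℝ) (z A : ℕ) (η : Path) : ℝ := listRevenue b v z (bits (endIndex z A η) η)

lemma measurable_reward (b v : ℝ) (z A : ℕ) : Measurable (reward b v z A) :=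
  measurable_eval_nat (measurable_endIndex z A) fun n => measurable_comp_bits (listRevenue b v z) n

lemma listRevenue_nonneg {b v : ℝ} (hb : 0 ≤ b) (hv : 0 ≤ v) (z : ℕ) (l : List Bool) :
    0 ≤ listRevenue b v z l := by
  unfold listRevenue
  split_ifs <;> positivity

lemma listRevenue_le {b v : ℝ} (hb : 0 ≤ b) (hv : 0 ≤ v) (z : ℕ) (l : List Bool) :
    listRevenue b v z l ≤ v + b * (1 + l.length) := by
  have h : (l.count true : ℝ) ≤ l.length := mod_cast List.count_le_length
  unfold listRevenue
  split_ifs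
  · push_cast
    gcongr
  · positivity

namespace ListSucceeds

variable {z : ℕ} {l : List Bool}

lemma two_mul_le_length (h : ListSucceeds z l) : 2 * z ≤ l.length := by
  grind [ListSucceeds]

lemma length_le_two_mul_count (h : ListSucceeds z l) : l.length ≤ 2 * l.count true := by
  grind [ListSucceeds]

lemma count_eq (h : ListSucceeds z l) (hl : l.length = 2 * z) : l.count true = z := by
  grind [ListSucceeds]

end ListSucceeds

lemma listSucceeds_of_count_eq {z : ℕ} {l : List Bool} (hl : l.length = 2 * z)
    (h : l.count true = z) : ListSucceeds z l := by
  grind [ListSucceeds]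

lemma endIndex_of_count_eq {z A : ℕ} (hA : z ≤ A) {η : Path}
    (h : (bits (2 * z) η).count true = z) : endIndex z A η = 2 * z := by
  have hsucc : ListSucceeds z (bits (2 * z) η) := listSucceeds_of_count_eq (length_bits _ _) h
  have hle : endIndex z A η ≤ 2 * z := Nat.sInf_le (Or.inl hsucc)
  have hfalse : (bits (endIndex z A η) η).count false ≤ z := by
    rw [← take_bits hle]
    refine ((List.take_sublist _ _).count_le false).trans (le_of_eq ?_)
    have := List.count_false_add_count_true (bits (2 * z) η)
    rw [length_bits] at this
    lia
  rcases listEnds_endIndex ⟨2 * z, Or.inl hsucc⟩ with hs | hg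
  · exact hle.antisymm (by simpa using hs.two_mul_le_length)
  · lia

lemma reward_of_count_eq {z A : ℕ} (hA : z ≤ A) {η : Path}
    (h : (bits (2 * z) η).count true = z) (b v : ℝ) : reward b v z A η = v + b * (z + 1) := by
  rw [reward, endIndex_of_count_eq hA h, listRevenue,
    if_pos (listSucceeds_of_count_eq (length_bits _ _) h), h]
  push_cast
  ring

lemma ofReal_reward_le {b v : ℝ} (hb : 0 ≤ b) (hv : 0 ≤ v) (z A : ℕ) (η : Path) :
    ENNReal.ofReal (reward b v z A η)
      ≤ {η | (bits (2 * z) η).count true = z}.indicator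
          (fun _ => ENNReal.ofReal (v + b * (z + 1))) η
        + ∑' m : ℕ, {η | 2 * z + 1 + m ≤ 2 * (bits (2 * z + 1 + m) η).count true}.indicator
          (fun _ => ENNReal.ofReal (v + b * (2 * z + 2 + m))) η := by
  by_cases hs : ListSucceeds z (bits (endIndex z A η) η)
  · rcases hs.two_mul_le_length.eq_or_lt with h | h <;> rw [length_bits] at h
    · have hcount := hs.count_eq (by simpa using h.symm)
      refine le_trans (le_of_eq ?_) le_self_add
      rw [Set.indicator_of_mem (by rwa [Set.mem_ofPred_eq, h]), reward, listRevenue, if_pos hs,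
        hcount]
      push_cast
      rw [add_comm (1 : ℝ)]
    · obtain ⟨m, hm⟩ := Nat.exists_eq_add_of_le (Nat.succ_le_of_lt h)
      have hhalf := hs.length_le_two_mul_count
      rw [length_bits, hm] at hhalf
      refine le_trans ?_ ((ENNReal.le_tsum m).trans le_add_self)
      rw [Set.indicator_of_mem (by simpa using hhalf)]
      refine ENNReal.ofReal_le_ofReal ((listRevenue_le hb hv z _).trans (le_of_eq ?_))
      rw [length_bits, hm]
      push_cast
      ring
  · simp [reward, listRevenue, hs]

section Law

variable {q τ₀ : ℝ}

lemma revenue_ae_eq (hτ : 0 < τ₀) (hq : 0 < q) (hq2 : q < 1 / 2) (z A : ℕ) (b v : ℝ) :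
    revenue b v z A =ᵐ[law q τ₀] fun ω => reward b v z A (afterPreMine ω) := by
  filter_upwards [ae_regular hτ hq (by linarith),
    ae_exists_listEnds_afterPreMine hτ hq hq2 z A] with ω h1 h2
  exact h1.revenue_eq h2 b v

lemma integrable_endIndex (hτ : 0 < τ₀) (hq : 0 < q) (hq2 : q < 1 / 2) (z A : ℕ) :
    Integrable (fun η => (endIndex z A η : ℝ)) (law q τ₀) := by
  have := isProbabilityMeasure_law hτ hq (by linarith)
  have hwald := lintegral_sum_range_endIndex hτ hq hq2 z A (g := 1) measurable_one
  simp only [Pi.one_apply, Finset.sum_const, Finset.card_range, nsmul_eq_mul, mul_one,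
    lintegral_one, measure_univ] at hwald
  refine ⟨(measurable_from_nat.comp (measurable_endIndex z A)).aestronglyMeasurable, ?_⟩
  rw [hasFiniteIntegral_iff_ofReal (ae_of_all _ fun η => Nat.cast_nonneg _)]
  simp only [ENNReal.ofReal_natCast, hwald]
  exact (tsum_running_le hτ hq hq2 z A).trans_lt ENNReal.ofReal_lt_top

lemma integrable_reward (hτ : 0 < τ₀) (hq : 0 < q) (hq2 : q < 1 / 2) (z A : ℕ) {b v : ℝ}
    (hb : 0 ≤ b) (hv : 0 ≤ v) : Integrable (reward b v z A) (law q τ₀) := by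
  have := isProbabilityMeasure_law hτ hq (by linarith)
  refine ((integrable_const v).add
    (((integrable_const 1).add (integrable_endIndex hτ hq hq2 z A)).const_mul b)).mono'
    (measurable_reward b v z A).aestronglyMeasurable (ae_of_all _ fun η => ?_)
  rw [reward, Real.norm_of_nonneg (listRevenue_nonneg hb hv z _)]
  simpa using listRevenue_le hb hv z (bits (endIndex z A η) η)

lemma integrable_revenue (hτ : 0 < τ₀) (hq : 0 < q) (hq2 : q < 1 / 2) (z A : ℕ) {b v : ℝ}
    (hb : 0 ≤ b) (hv : 0 ≤ v) : Integrable (revenue b v z A) (law q τ₀) :=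
  ((measurePreserving_afterPreMine hτ hq (by linarith)).integrable_comp_of_integrable
    (integrable_reward hτ hq hq2 z A hb hv)).congr (revenue_ae_eq hτ hq hq2 z A b v).symm

lemma ofReal_integral_revenue (hτ : 0 < τ₀) (hq : 0 < q) (hq2 : q < 1 / 2) (z A : ℕ) {b v : ℝ}
    (hb : 0 ≤ b) (hv : 0 ≤ v) :
    ENNReal.ofReal (∫ ω, revenue b v z A ω ∂law q τ₀)
      = ∫⁻ η, ENNReal.ofReal (reward b v z A η) ∂law q τ₀ := by
  have hae := revenue_ae_eq hτ hq hq2 z A b v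
  rw [ofReal_integral_eq_lintegral_ofReal (integrable_revenue hτ hq hq2 z A hb hv)
      (hae.mono fun ω hω => by rw [hω]; exact listRevenue_nonneg hb hv z _)]
  refine (lintegral_congr_ae (hae.fun_comp ENNReal.ofReal)).trans ?_
  exact (measurePreserving_afterPreMine hτ hq (by linarith)).lintegral_comp
    (measurable_reward b v z A).ennreal_ofReal

lemma law_count_two_mul_eq (hτ : 0 < τ₀) (hq : 0 < q) (hq1 : q < 1) (z : ℕ) :
    law q τ₀ {ω | (bits (2 * z) ω).count true = z}
      = ENNReal.ofReal ((2 * z).choose z * (q ^ z * (1 - q) ^ z)) := by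
  rw [law_count_eq hτ hq hq1, show 2 * z - z = z by lia,
    ENNReal.ofReal_mul (Nat.cast_nonneg _), ENNReal.ofReal_mul (by positivity),
    ENNReal.ofReal_pow hq.le, ENNReal.ofReal_pow (by linarith), ENNReal.ofReal_natCast, mul_assoc]
  simp [prob]

lemma le_integral_revenue (hτ : 0 < τ₀) (hq : 0 < q) (hq2 : q < 1 / 2) {z A : ℕ} (hA : z ≤ A)
    {b v : ℝ} (hb : 0 ≤ b) (hv : 0 ≤ v) :
    (2 * z).choose z * (q ^ z * (1 - q) ^ z) * (v + b * (z + 1))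
      ≤ ∫ ω, revenue b v z A ω ∂law q τ₀ := by
  have hmeas : MeasurableSet {ω | (bits (2 * z) ω).count true = z} :=
    measurableSet_bits (fun l => l.count true = z) _
  have hnonneg : 0 ≤ ∫ ω, revenue b v z A ω ∂law q τ₀ := by
    refine integral_nonneg_of_ae ((revenue_ae_eq hτ hq hq2 z A b v).mono fun ω hω => ?_)
    rw [hω]
    exact listRevenue_nonneg hb hv z _
  rw [← ENNReal.ofReal_le_ofReal_iff hnonneg, ofReal_integral_revenue hτ hq hq2 z A hb hv, mul_comm,
    ENNReal.ofReal_mul (by positivity), ← law_count_two_mul_eq hτ hq (by linarith),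
    ← setLIntegral_const]
  refine le_trans ?_ (setLIntegral_le_lintegral {ω | (bits (2 * z) ω).count true = z} _)
  exact setLIntegral_mono' hmeas fun η hη => by rw [reward_of_count_eq hA hη]

/-- Chernoff's bound, from the moment generating function at `q⁻¹`. -/
lemma law_le_two_mul_count_le (hτ : 0 < τ₀) (hq : 0 < q) (hq1 : q < 1) (n : ℕ) :
    law q τ₀ {ω | n ≤ 2 * (bits n ω).count true} ≤ ENNReal.ofReal ((2 * √q) ^ n) := by
  set s := {ω : Path | n ≤ 2 * (bits n ω).count true}
  have hs : MeasurableSet s := measurableSet_bits (fun l => n ≤ 2 * l.count true) n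
  have hpoint (ω : Path) : s.indicator 1 ω
      ≤ ENNReal.ofReal (√q ^ n) * ENNReal.ofReal q⁻¹ ^ (bits n ω).count true := by
    refine Set.indicator_apply_le' (fun hω => ?_) (fun _ => zero_le)
    rw [← ENNReal.ofReal_pow (by positivity), ← ENNReal.ofReal_mul (by positivity), Pi.one_apply,
      ENNReal.one_le_ofReal, inv_pow, ← div_eq_mul_inv, one_le_div₀ (by positivity)]
    calc q ^ (bits n ω).count true = √q ^ (2 * (bits n ω).count true) := by
          rw [pow_mul, Real.sq_sqrt hq.le]
      _ ≤ √q ^ n := pow_le_pow_of_le_one (by positivity) (Real.sqrt_le_one.2 hq1.le) hω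
  have hmgf : prob q false + prob q true * ENNReal.ofReal q⁻¹ ≤ ENNReal.ofReal 2 := by
    simp only [prob, Bool.false_eq_true, if_false, if_true]
    rw [← ENNReal.ofReal_mul hq.le, ← ENNReal.ofReal_add (by linarith) (by positivity),
      mul_inv_cancel₀ hq.ne']
    exact ENNReal.ofReal_le_ofReal (by linarith)
  calc law q τ₀ s = ∫⁻ ω, s.indicator 1 ω ∂law q τ₀ := (lintegral_indicator_one hs).symm
    _ ≤ ∫⁻ ω, ENNReal.ofReal (√q ^ n) * ENNReal.ofReal q⁻¹ ^ (bits n ω).count true ∂law q τ₀ :=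
        lintegral_mono hpoint
    _ = ENNReal.ofReal (√q ^ n) * (prob q false + prob q true * ENNReal.ofReal q⁻¹) ^ n := by
        rw [lintegral_const_mul _ (measurable_comp_bits
          (fun l => ENNReal.ofReal q⁻¹ ^ l.count true) n), lintegral_pow_count hτ hq hq1]
    _ ≤ ENNReal.ofReal (√q ^ n) * ENNReal.ofReal 2 ^ n := by gcongr
    _ = ENNReal.ofReal ((2 * √q) ^ n) := by
        rw [mul_pow, mul_comm, ENNReal.ofReal_mul (by positivity), ENNReal.ofReal_pow zero_le_two]

lemma hasSum_add_mul_mul_half_pow (a b : ℝ) :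
    HasSum (fun m : ℕ => (a + b * m) * (1 / 2) ^ m) (2 * a + 2 * b) := by
  have h1 := hasSum_geometric_two.mul_left a
  have h2 := (hasSum_coe_mul_geometric_of_norm_lt_one (𝕜 := ℝ) (r := 1 / 2)
    (by norm_num)).mul_left b
  convert! h1.add h2 using 1
  · ext m; ring
  · norm_num; ring

lemma two_mul_sqrt_pow_le (hq : 0 < q) (hq16 : q ≤ 1 / 16) (z m : ℕ) :
    (2 * √q) ^ (2 * z + 1 + m) ≤ 2 ^ (2 * z + 1) * (q ^ z * √q) * (1 / 2) ^ m := by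
  have hsqrt : √q ≤ 1 / 4 := by
    rw [Real.sqrt_le_left (by norm_num)]
    linarith
  calc (2 * √q) ^ (2 * z + 1 + m) = 2 ^ (2 * z + 1) * (q ^ z * √q) * (2 * √q) ^ m := by
        rw [pow_add, mul_pow, pow_succ (√q), pow_mul (√q), Real.sq_sqrt hq.le]
    _ ≤ 2 ^ (2 * z + 1) * (q ^ z * √q) * (1 / 2) ^ m := by
        gcongr
        linarith

lemma tsum_mul_law_le_two_mul_count_le (hτ : 0 < τ₀) (hq : 0 < q) (hq16 : q ≤ 1 / 16) (z : ℕ)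
    {a b : ℝ} (ha : 0 ≤ a) (hb : 0 ≤ b) :
    ∑' m : ℕ, ENNReal.ofReal (a + b * m)
        * law q τ₀ {ω | 2 * z + 1 + m ≤ 2 * (bits (2 * z + 1 + m) ω).count true}
      ≤ ENNReal.ofReal (2 ^ (2 * z + 1) * (q ^ z * √q) * (2 * a + 2 * b)) := by
  have hsum := (hasSum_add_mul_mul_half_pow a b).mul_left (2 ^ (2 * z + 1) * (q ^ z * √q))
  rw [← hsum.tsum_eq, ENNReal.ofReal_tsum_of_nonneg (fun m => by positivity) hsum.summable]
  refine ENNReal.tsum_le_tsum fun m => ?_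
  refine (mul_le_mul_right (law_le_two_mul_count_le hτ hq (by linarith) _) _).trans ?_
  rw [← ENNReal.ofReal_mul (by positivity), mul_left_comm]
  gcongr
  exact two_mul_sqrt_pow_le hq hq16 z m

lemma integral_revenue_le (hτ : 0 < τ₀) (hq : 0 < q) (hq16 : q ≤ 1 / 16) (z A : ℕ)
    {b v : ℝ} (hb : 0 ≤ b) (hv : 0 ≤ v) :
    ∫ ω, revenue b v z A ω ∂law q τ₀ ≤ (2 * z).choose z * q ^ z * (v + b * (z + 1))
      + 2 ^ (2 * z + 1) * (q ^ z * √q) * (2 * (v + b * (2 * z + 2)) + 2 * b) := by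
  have hq1 : q < 1 := by linarith
  have hmeas (n k : ℕ) : MeasurableSet {ω | (bits n ω).count true = k} :=
    measurableSet_bits (fun l => l.count true = k) n
  have hmeas' (n : ℕ) : MeasurableSet {ω | n ≤ 2 * (bits n ω).count true} :=
    measurableSet_bits (fun l => n ≤ 2 * l.count true) n
  have hfirst : law q τ₀ {ω | (bits (2 * z) ω).count true = z}
      ≤ ENNReal.ofReal ((2 * z).choose z * q ^ z) := by
    rw [law_count_two_mul_eq hτ hq hq1]
    gcongr
    exact mul_le_of_le_one_right (by positivity) (pow_le_one₀ (by linarith) (by linarith))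
  rw [← ENNReal.ofReal_le_ofReal_iff (by positivity),
    ofReal_integral_revenue hτ hq (by linarith) z A hb hv,
    ENNReal.ofReal_add (by positivity) (by positivity)]
  refine (lintegral_mono (ofReal_reward_le hb hv z A)).trans ?_
  rw [lintegral_add_left (measurable_const.indicator (hmeas _ _)),
    lintegral_indicator_const (hmeas _ _),
    lintegral_tsum fun m => (measurable_const.indicator (hmeas' _)).aemeasurable]
  simp only [lintegral_indicator_const (hmeas' _), mul_add b, ← add_assoc v]
  refine add_le_add ?_ (by
    simpa only [mul_add b, ← add_assoc v] using
      tsum_mul_law_le_two_mul_count_le hτ hq hq16 z (by positivity) hb)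
  rw [mul_comm, ENNReal.ofReal_mul (by positivity)]
  gcongr

end Law

/-! ### Asymptotics of the revenue ratio -/

lemma choose_two_mul {z : ℕ} (hz : 1 ≤ z) : (2 * z).choose z = 2 * (2 * z - 1).choose z := by
  obtain ⟨m, rfl⟩ := Nat.exists_eq_add_of_le' hz
  rw [show 2 * (m + 1) = (2 * m + 1) + 1 by ring, Nat.choose_succ_succ, Nat.add_sub_cancel,
    Nat.choose_symm_half]
  ring

lemma one_le_choose_two_mul (z : ℕ) : (1 : ℝ) ≤ (2 * z).choose z :=
  mod_cast Nat.choose_pos (by lia)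

lemma one_div_beta_self {z : ℕ} (hz : 1 ≤ z) :
    1 / beta z z = z * ((2 * z - 1).choose z : ℝ) := by
  obtain ⟨m, rfl⟩ := Nat.exists_eq_add_of_le' hz
  have hsum : ((m + 1 : ℕ) : ℝ) + ((m + 1 : ℕ) : ℝ) = ((2 * m + 1 : ℕ) : ℝ) + 1 := by
    push_cast
    ring
  rw [beta, hsum, Real.Gamma_nat_eq_factorial, Nat.cast_succ m, Real.Gamma_nat_eq_factorial,
    show 2 * (m + 1) - 1 = 2 * m + 1 by lia,
    Nat.cast_choose ℝ (show m + 1 ≤ 2 * m + 1 by lia),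
    show 2 * m + 1 - (m + 1) = m by lia, Nat.factorial_succ m]
  push_cast
  field_simp

lemma leadingTerm_eq {τ₀ b v q : ℝ} {z : ℕ} (hb : b ≠ 0) (hz : 1 ≤ z) :
    leadingTerm τ₀ b v z q = (2 * z).choose z * q ^ z * (v + b * (z + 1)) / (τ₀ / q) := by
  rw [leadingTerm, choose_two_mul hz, show (2 : ℝ) / beta z z = 2 * (1 / beta z z) by ring,
    one_div_beta_self hz]
  push_cast
  field_simp
  ring

lemma threshold_eq {b q : ℝ} {z : ℕ} (hz : 1 ≤ z) :
    threshold b z q = b / ((2 * z).choose z * q ^ z) := by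
  rw [threshold, choose_two_mul hz]
  push_cast
  rw [div_mul_eq_mul_div, inv_mul_eq_div, div_div, mul_comm (q ^ z)]

lemma mul_add_one_eq_mul_threshold {b q : ℝ} {z : ℕ} (hz : 1 ≤ z) (hq : q ≠ 0) :
    b * (z + 1) = (z + 1) * (2 * z).choose z * q ^ z * threshold b z q := by
  have := one_le_choose_two_mul z
  rw [threshold_eq hz]
  field_simp

lemma threshold_mul_leadingTerm {τ₀ b v q : ℝ} {z : ℕ} (hb : b ≠ 0) (hz : 1 ≤ z) (hq : q ≠ 0) :
    threshold b z q * leadingTerm τ₀ b v z q = honestRatio τ₀ b q * (v + b * (z + 1)) := by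
  have := one_le_choose_two_mul z
  rw [leadingTerm_eq hb hz, threshold_eq hz, honestRatio]
  field_simp

section Law

variable {q τ₀ b v ε : ℝ} {z A : ℕ}

lemma leadingTerm_pos (hτ : 0 < τ₀) (hb : 0 < b) (hz : 1 ≤ z) (hq : 0 < q) (hv : 0 ≤ v) :
    0 < leadingTerm τ₀ b v z q := by
  have := one_le_choose_two_mul z
  rw [leadingTerm_eq hb.ne' hz]
  positivity

lemma threshold_pos (hb : 0 < b) (hz : 1 ≤ z) (hq : 0 < q) : 0 < threshold b z q := by
  have := one_le_choose_two_mul z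
  rw [threshold_eq hz]
  positivity

lemma revenueRatio_le (hτ : 0 < τ₀) (hb : 0 < b) (hz : 1 ≤ z) (hq : 0 < q) (hq16 : q ≤ 1 / 16)
    (hv : 0 ≤ v) (A : ℕ) :
    revenueRatio τ₀ b v z A q ≤ (1 + 6 * 2 ^ (2 * z + 1) * √q) * leadingTerm τ₀ b v z q := by
  have hlinear : 2 * (v + b * (2 * z + 2)) + 2 * b
      ≤ 6 * ((2 * z).choose z * (v + b * (z + 1))) := by
    have : v + b * (z + 1) ≤ (2 * z).choose z * (v + b * (z + 1)) :=
      le_mul_of_one_le_left (by positivity) (one_le_choose_two_mul z)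
    have : 0 ≤ b * z := by positivity
    linarith
  have hrevenue : ∫ ω, revenue b v z A ω ∂law q τ₀
      ≤ (1 + 6 * 2 ^ (2 * z + 1) * √q) * ((2 * z).choose z * q ^ z * (v + b * (z + 1))) :=
    calc _ ≤ (2 * z).choose z * q ^ z * (v + b * (z + 1))
          + 2 ^ (2 * z + 1) * (q ^ z * √q) * (6 * ((2 * z).choose z * (v + b * (z + 1)))) := by
          refine (integral_revenue_le hτ hq hq16 z A hb.le hv).trans ?_
          gcongr
      _ = _ := by ring
  rw [leadingTerm_eq hb.ne' hz, revenueRatio, ← mul_div_assoc]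
  exact div_le_div₀ (by positivity) hrevenue (by positivity)
    (le_integral_duration hτ hq (by linarith) z A)

lemma integral_duration_le_mul (hτ : 0 < τ₀) (hq : 0 < q) (hq16 : q ≤ 1 / 16) (z : ℕ)
    (hA : 1 ≤ A) : ∫ ω, duration z A ω ∂law q τ₀ ≤ (1 + 4 * (q * A)) * (τ₀ / q) := by
  have hA' : (1 : ℝ) ≤ A := mod_cast hA
  have hattack : (A + 1) / (1 - 2 * q) * (τ₀ / (1 - q)) ≤ 4 * A * τ₀ := by
    have hhalf : 1 / 2 ≤ (1 - 2 * q) * (1 - q) := by nlinarith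
    rw [div_mul_div_comm, div_le_iff₀ (by linarith)]
    calc (A + 1) * τ₀ ≤ 4 * A * τ₀ * (1 / 2) := by nlinarith
      _ ≤ 4 * A * τ₀ * ((1 - 2 * q) * (1 - q)) := by gcongr
  calc _ ≤ τ₀ / q + 4 * A * τ₀ :=
        (integral_duration_le hτ hq (by linarith) z A).trans (by gcongr)
    _ = _ := by field_simp

lemma le_revenueRatio (hτ : 0 < τ₀) (hb : 0 < b) (hz : 1 ≤ z) (hq : 0 < q) (hq16 : q ≤ 1 / 16)
    (hv : 0 ≤ v) (hA : z ≤ A) :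
    (1 - z * q) * leadingTerm τ₀ b v z q ≤ (1 + 4 * (q * A)) * revenueRatio τ₀ b v z A q := by
  have hq2 : q < 1 / 2 := by linarith
  have hbernoulli : 1 - z * q ≤ (1 - q) ^ z := by
    simpa [sub_eq_add_neg] using one_add_mul_le_pow (a := -q) (by linarith) z
  have hrevenue : (1 - z * q) * ((2 * z).choose z * q ^ z * (v + b * (z + 1)))
      ≤ ∫ ω, revenue b v z A ω ∂law q τ₀ :=
    calc _ ≤ (1 - q) ^ z * ((2 * z).choose z * q ^ z * (v + b * (z + 1))) := by gcongr
      _ = (2 * z).choose z * (q ^ z * (1 - q) ^ z) * (v + b * (z + 1)) := by ring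
      _ ≤ _ := le_integral_revenue hτ hq hq2 hA hb.le hv
  have hduration := integral_duration_pos hτ hq hq2 z A
  have hpow : 0 ≤ (1 - q) ^ z := pow_nonneg (by linarith) z
  have hrevenue_nonneg : 0 ≤ ∫ ω, revenue b v z A ω ∂law q τ₀ :=
    le_trans (by positivity) (le_integral_revenue hτ hq hq2 hA hb.le hv)
  rw [leadingTerm_eq hb.ne' hz, revenueRatio, ← mul_div_assoc, ← mul_div_assoc,
    div_le_div_iff₀ (by positivity) hduration]
  calc _ ≤ (∫ ω, revenue b v z A ω ∂law q τ₀) * ∫ ω, duration z A ω ∂law q τ₀ := by gcongr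
    _ ≤ (∫ ω, revenue b v z A ω ∂law q τ₀) * ((1 + 4 * (q * A)) * (τ₀ / q)) := by
        gcongr
        exact integral_duration_le_mul hτ hq hq16 z (hz.trans hA)
    _ = _ := by ring

lemma exists_revenueRatio_bounds (hτ : 0 < τ₀) (hb : 0 < b) (hz : 1 ≤ z) (hε : 0 < ε) :
    ∃ δ : ℝ, 0 < δ ∧ δ < 1 / 2 ∧ ∀ q : ℝ, 0 < q → q ≤ δ → ∀ A : ℕ, z ≤ A → ∀ v : ℝ, 0 ≤ v →
      revenueRatio τ₀ b v z A q ≤ (1 + ε) * leadingTerm τ₀ b v z q ∧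
      (q * A ≤ δ → (1 - ε) * leadingTerm τ₀ b v z q ≤ revenueRatio τ₀ b v z A q) := by
  set K : ℝ := 6 * 2 ^ (2 * z + 1)
  have hK : 0 < K := by positivity
  refine ⟨min (1 / 16) (min ((ε / K) ^ 2) (ε / (z + 4))), by positivity,
    (min_le_left _ _).trans_lt (by norm_num), fun q hq hqδ A hA v hv => ?_⟩
  simp only [le_min_iff] at hqδ ⊢
  obtain ⟨hq16, hqK, -⟩ := hqδ
  have hL := leadingTerm_pos hτ hb hz hq hv
  refine ⟨(revenueRatio_le hτ hb hz hq hq16 hv A).trans ?_, fun ⟨_, _, hqA⟩ => ?_⟩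
  · have : K * √q ≤ ε := (le_div_iff₀' hK).1 (Real.sqrt_le_iff.2 ⟨by positivity, hqK⟩)
    gcongr
  · rw [le_div_iff₀ (by positivity)] at hqA
    have hqA0 : 0 ≤ q * A := by positivity
    have hA' : (1 : ℝ) ≤ A := mod_cast hz.trans hA
    refine le_of_mul_le_mul_left (le_trans ?_ (le_revenueRatio hτ hb hz hq hq16 hv hA))
      (show 0 < 1 + 4 * (q * A) by positivity)
    rw [← mul_assoc]
    gcongr
    have : z * q ≤ q * A * z := by
      rw [mul_comm (z : ℝ)]
      exact mul_le_mul_of_nonneg_right (le_mul_of_one_le_right hq.le hA') (Nat.cast_nonneg z)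
    nlinarith [mul_nonneg hε.le hqA0]

/-! ### The minimal profitable amount -/

lemma revenue_eq_add (b v : ℝ) (z A : ℕ) (ω : Path) :
    revenue b v z A ω = v * revenue 0 1 z A ω + b * revenue 1 0 z A ω := by
  unfold revenue
  split_ifs <;> ring

lemma integral_revenue_eq_add (hτ : 0 < τ₀) (hq : 0 < q) (hq2 : q < 1 / 2) (b v : ℝ) (z A : ℕ) :
    ∫ ω, revenue b v z A ω ∂law q τ₀ = v * ∫ ω, revenue 0 1 z A ω ∂law q τ₀
      + b * ∫ ω, revenue 1 0 z A ω ∂law q τ₀ := by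
  have hamount := integrable_revenue hτ hq hq2 z A le_rfl zero_le_one
  have hblocks := integrable_revenue hτ hq hq2 z A zero_le_one le_rfl
  simp_rw [revenue_eq_add b v]
  rw [integral_add (hamount.const_mul v) (hblocks.const_mul b), integral_const_mul,
    integral_const_mul]

lemma isLeast_minimalAmount (hτ : 0 < τ₀) (hq : 0 < q) (hq2 : q < 1 / 2) (hA : z ≤ A) (b : ℝ) :
    IsLeast (profitableAmounts τ₀ b z A q) (minimalAmount τ₀ b z A q) := by
  have hD := integral_duration_pos hτ hq hq2 z A
  have hP : 0 < ∫ ω, revenue 0 1 z A ω ∂law q τ₀ := by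
    refine lt_of_lt_of_le ?_ (le_integral_revenue hτ hq hq2 hA le_rfl zero_le_one)
    have := one_le_choose_two_mul z
    have : 0 < 1 - q := by linarith
    positivity
  set D := ∫ ω, duration z A ω ∂law q τ₀ with hD_def
  set P := ∫ ω, revenue 0 1 z A ω ∂law q τ₀ with hP_def
  set Q := ∫ ω, revenue 1 0 z A ω ∂law q τ₀ with hQ_def
  have h : profitableAmounts τ₀ b z A q
      = Set.Ici (max 0 ((honestRatio τ₀ b q * D - b * Q) / P)) := by
    ext v
    simp only [profitableAmounts, Set.mem_ofPred_eq, Set.mem_Ici, max_le_iff, revenueRatio]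
    rw [integral_revenue_eq_add hτ hq hq2 b v, ← hD_def, ← hP_def, ← hQ_def, le_div_iff₀ hD,
      div_le_iff₀ hP, sub_le_iff_le_add]
  rw [minimalAmount, h, csInf_Ici]
  exact isLeast_Ici

lemma le_of_honestRatio_le_revenueRatio (hτ : 0 < τ₀) (hb : 0 < b) (hz : 1 ≤ z) (hq : 0 < q)
    (hv : 0 ≤ v)
    (hratio : revenueRatio τ₀ b v z A q ≤ (1 + ε) * leadingTerm τ₀ b v z q)
    (hsmall : b * (z + 1) ≤ ε * threshold b z q)
    (h : honestRatio τ₀ b q ≤ revenueRatio τ₀ b v z A q) : (1 - 2 * ε) * threshold b z q ≤ v := by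
  have hT := threshold_pos hb hz hq
  have hhonest : 0 < honestRatio τ₀ b q := by
    rw [honestRatio]
    positivity
  have hle : threshold b z q ≤ (1 + ε) * (v + b * (z + 1)) := by
    refine le_of_mul_le_mul_left ?_ hhonest
    calc honestRatio τ₀ b q * threshold b z q
        ≤ (1 + ε) * leadingTerm τ₀ b v z q * threshold b z q := by
          gcongr
          exact h.trans hratio
      _ = (1 + ε) * (threshold b z q * leadingTerm τ₀ b v z q) := by ring
      _ = honestRatio τ₀ b q * ((1 + ε) * (v + b * (z + 1))) := by
          rw [threshold_mul_leadingTerm hb.ne' hz hq.ne']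
          ring
  suffices (1 - ε) * threshold b z q ≤ v + b * (z + 1) by linarith
  rcases le_total 1 ε with hε1 | hε1
  · exact (mul_nonpos_of_nonpos_of_nonneg (by linarith) hT.le).trans (by positivity)
  · calc (1 - ε) * threshold b z q ≤ (1 - ε) * ((1 + ε) * (v + b * (z + 1))) :=
          mul_le_mul_of_nonneg_left hle (by linarith)
      _ = (1 - ε ^ 2) * (v + b * (z + 1)) := by ring
      _ ≤ v + b * (z + 1) :=
          mul_le_of_le_one_left (by positivity) (sub_le_self 1 (sq_nonneg ε))

lemma honestRatio_lt_revenueRatio {η : ℝ} (hτ : 0 < τ₀) (hb : 0 < b) (hz : 1 ≤ z) (hq : 0 < q)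
    (hη : η < 1) (hεη : 1 ≤ (1 - η) * (1 + ε))
    (hratio : (1 - η) * leadingTerm τ₀ b v z q ≤ revenueRatio τ₀ b v z A q)
    (h : (1 + ε) * threshold b z q ≤ v) : honestRatio τ₀ b q < revenueRatio τ₀ b v z A q := by
  have hT := threshold_pos hb hz hq
  have hhonest : 0 < honestRatio τ₀ b q := by
    rw [honestRatio]
    positivity
  refine lt_of_lt_of_le (lt_of_mul_lt_mul_left ?_ hT.le) hratio
  calc threshold b z q * honestRatio τ₀ b q
      ≤ (1 - η) * (honestRatio τ₀ b q * ((1 + ε) * threshold b z q)) := by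
        rw [show (1 - η) * (honestRatio τ₀ b q * ((1 + ε) * threshold b z q))
          = (1 - η) * (1 + ε) * (threshold b z q * honestRatio τ₀ b q) by ring]
        exact le_mul_of_one_le_left (by positivity) hεη
    _ < (1 - η) * (honestRatio τ₀ b q * (v + b * (z + 1))) := by
        have : 0 < b * (z + 1) := by positivity
        gcongr
        linarith
    _ = threshold b z q * ((1 - η) * leadingTerm τ₀ b v z q) := by
        rw [← threshold_mul_leadingTerm hb.ne' hz hq.ne']
        ring

lemma mul_add_one_le_mul_threshold (hb : 0 < b) (hz : 1 ≤ z) (hq : 0 < q) (hq1 : q ≤ 1)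
    (hqε : q ≤ ε / ((z + 1) * (2 * z).choose z)) : b * (z + 1) ≤ ε * threshold b z q := by
  have hC := one_le_choose_two_mul z
  have hT := threshold_pos hb hz hq
  rw [le_div_iff₀' (by positivity)] at hqε
  rw [mul_add_one_eq_mul_threshold hz hq.ne']
  gcongr
  refine le_trans ?_ hqε
  gcongr
  exact pow_le_of_le_one hq.le hq1 (by lia)

lemma exists_profitable_bounds (hτ : 0 < τ₀) (hb : 0 < b) (hz : 1 ≤ z) (hε : 0 < ε) :
    ∃ δ : ℝ, 0 < δ ∧ δ < 1 / 2 ∧ ∀ q : ℝ, 0 < q → q ≤ δ → ∀ A : ℕ, z ≤ A → ∀ v : ℝ, 0 ≤ v →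
      (honestRatio τ₀ b q ≤ revenueRatio τ₀ b v z A q → (1 - ε) * threshold b z q ≤ v) ∧
      (q * A ≤ δ → (1 + ε) * threshold b z q ≤ v →
        honestRatio τ₀ b q < revenueRatio τ₀ b v z A q) := by
  have hC := one_le_choose_two_mul z
  set η : ℝ := ε / (2 * (1 + ε)) with hη_def
  have hη : 0 < η := by positivity
  have hη_mul : η * (1 + ε) = ε / 2 := by
    rw [hη_def]
    field_simp
  obtain ⟨δ, hδ, hδ2, hratio⟩ := exists_revenueRatio_bounds hτ hb hz hη
  refine ⟨min δ (η / ((z + 1) * (2 * z).choose z)), by positivity, (min_le_left _ _).trans_lt hδ2,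
    fun q hq hqδ A hA v hv => ?_⟩
  rw [le_min_iff] at hqδ
  obtain ⟨hupper, hlower⟩ := hratio q hq hqδ.1 A hA v hv
  refine ⟨fun h => ?_, fun hqA h => ?_⟩
  · have hsmall := mul_add_one_le_mul_threshold hb hz hq (by linarith) hqδ.2
    refine le_trans ?_ (le_of_honestRatio_le_revenueRatio hτ hb hz hq hv hupper hsmall h)
    have := (threshold_pos hb hz hq).le
    gcongr
    nlinarith
  · exact honestRatio_lt_revenueRatio hτ hb hz hq (by nlinarith) (by linarith)
      (hlower (hqA.trans (min_le_left _ _))) h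

end Law

/-! ### Asymptotic equivalents -/

lemma isEquivalent_of_forall_exists {f g : ℝ → ℝ} (hg : ∀ q, 0 < q → 0 < g q) (A : ℕ)
    (h : ∀ ε : ℝ, 0 < ε → ∃ δ : ℝ, 0 < δ ∧ ∀ q, 0 < q → q ≤ δ → q * A ≤ δ →
      (1 - ε) * g q ≤ f q ∧ f q ≤ (1 + ε) * g q) : f ~[𝓝[>] 0] g := by
  refine isLittleO_iff.2 fun ε hε => ?_
  obtain ⟨δ, hδ, h⟩ := h ε hε
  have hδA : 0 < δ / (A + 1) := by positivity
  filter_upwards [Ioc_mem_nhdsGT hδA] with q ⟨hq, hqδ⟩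
  rw [le_div_iff₀ (by positivity)] at hqδ
  have : 0 ≤ q * A := by positivity
  obtain ⟨hlower, hupper⟩ := h q hq (by linarith) (by linarith)
  rw [Real.norm_of_nonneg (hg q hq).le, Pi.sub_apply, Real.norm_eq_abs, abs_le]
  exact ⟨by linarith, by linarith⟩

section Equivalents

variable {τ₀ b v : ℝ} {z A : ℕ}

lemma isEquivalent_revenueRatio (hτ : 0 < τ₀) (hb : 0 < b) (hz : 1 ≤ z) (hA : z ≤ A)
    (hv : 0 ≤ v) : revenueRatio τ₀ b v z A ~[𝓝[>] 0] leadingTerm τ₀ b v z := by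
  refine isEquivalent_of_forall_exists (fun q hq => leadingTerm_pos hτ hb hz hq hv) A
    fun ε hε => ?_
  obtain ⟨δ, hδ, -, h⟩ := exists_revenueRatio_bounds hτ hb hz hε
  exact ⟨δ, hδ, fun q hq hqδ hqA => ⟨(h q hq hqδ A hA v hv).2 hqA, (h q hq hqδ A hA v hv).1⟩⟩

lemma isEquivalent_minimalAmount (hτ : 0 < τ₀) (hb : 0 < b) (hz : 1 ≤ z) (hA : z ≤ A) :
    minimalAmount τ₀ b z A ~[𝓝[>] 0] threshold b z := by
  refine isEquivalent_of_forall_exists (fun q hq => threshold_pos hb hz hq) A fun ε hε => ?_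
  obtain ⟨δ, hδ, hδ2, h⟩ := exists_profitable_bounds hτ hb hz hε
  refine ⟨δ, hδ, fun q hq hqδ hqA => ?_⟩
  obtain ⟨⟨hnonneg, hprofitable⟩, hleast⟩ :=
    isLeast_minimalAmount hτ hq (by linarith : q < 1 / 2) hA b
  have hT : 0 ≤ (1 + ε) * threshold b z q :=
    mul_nonneg (by linarith) (threshold_pos hb hz hq).le
  exact ⟨(h q hq hqδ A hA _ hnonneg).1 hprofitable,
    hleast ⟨hT, ((h q hq hqδ A hA _ hT).2 hqA le_rfl).le⟩⟩

end Equivalents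

end DoubleSpend

end

theorem mainTheorem3 (τ₀ b : ℝ) (hτ₀ : 0 < τ₀) (hb : 0 < b) (z : ℕ) (hz : 1 ≤ z) :
    -- the attack cycle ends almost surely and is integrable, and a minimal profitable amount exists
    (∀ q : ℝ, 0 < q → q < 1 / 2 → ∀ A : ℕ, max 2 z ≤ A →
      (∀ᵐ ω ∂(DoubleSpend.law q τ₀), (DoubleSpend.endTimes z A ω).Nonempty) ∧
      Integrable (DoubleSpend.duration z A) (DoubleSpend.law q τ₀) ∧
      0 < ∫ ω, DoubleSpend.duration z A ω ∂(DoubleSpend.law q τ₀) ∧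
      (∀ v : ℝ, 0 ≤ v → Integrable (DoubleSpend.revenue b v z A) (DoubleSpend.law q τ₀)) ∧
      IsLeast (DoubleSpend.profitableAmounts τ₀ b z A q) (DoubleSpend.minimalAmount τ₀ b z A q)) ∧
    -- asymptotics of the revenue ratio, the same for every `A`
    (∀ v : ℝ, 0 ≤ v → ∀ A : ℕ, max 2 z ≤ A →
      DoubleSpend.revenueRatio τ₀ b v z A ~[𝓝[>] 0] DoubleSpend.leadingTerm τ₀ b v z) ∧
    -- uniformity in `A`: upper bound for all `A`, lower bound as long as `q * A` is small
    (∀ v : ℝ, 0 ≤ v → ∀ ε : ℝ, 0 < ε → ∃ δ : ℝ, 0 < δ ∧ δ < 1 / 2 ∧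
      ∀ q : ℝ, 0 < q → q ≤ δ → ∀ A : ℕ, max 2 z ≤ A →
        DoubleSpend.revenueRatio τ₀ b v z A q ≤ (1 + ε) * DoubleSpend.leadingTerm τ₀ b v z q ∧
        (q * A ≤ δ →
          (1 - ε) * DoubleSpend.leadingTerm τ₀ b v z q ≤
            DoubleSpend.revenueRatio τ₀ b v z A q)) ∧
    -- the minimal profitable amount is asymptotic to `v₀`
    (∀ A : ℕ, max 2 z ≤ A →
      DoubleSpend.minimalAmount τ₀ b z A ~[𝓝[>] 0] DoubleSpend.threshold b z) ∧
    -- uniformly in `A`, amounts below `(1 - ε) v₀` are not profitable, and amounts above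
    -- `(1 + ε) v₀` are strictly profitable as long as `q * A` is small
    (∀ ε : ℝ, 0 < ε → ∃ δ : ℝ, 0 < δ ∧ δ < 1 / 2 ∧
      ∀ q : ℝ, 0 < q → q ≤ δ → ∀ A : ℕ, max 2 z ≤ A → ∀ v : ℝ, 0 ≤ v →
        (DoubleSpend.honestRatio τ₀ b q ≤ DoubleSpend.revenueRatio τ₀ b v z A q →
          (1 - ε) * DoubleSpend.threshold b z q ≤ v) ∧
        (q * A ≤ δ → (1 + ε) * DoubleSpend.threshold b z q ≤ v →
          DoubleSpend.honestRatio τ₀ b q < DoubleSpend.revenueRatio τ₀ b v z A q)) := by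
  refine ⟨fun q hq hq2 A hA => ⟨?_, ?_, ?_, fun v hv => ?_, ?_⟩, fun v hv A hA => ?_,
    fun v hv ε hε => ?_, fun A hA => ?_, fun ε hε => ?_⟩
  · exact DoubleSpend.ae_nonempty_endTimes hτ₀ hq hq2 z A
  · exact DoubleSpend.integrable_duration hτ₀ hq hq2 z A
  · exact DoubleSpend.integral_duration_pos hτ₀ hq hq2 z A
  · exact DoubleSpend.integrable_revenue hτ₀ hq hq2 z A hb.le hv
  · exact DoubleSpend.isLeast_minimalAmount hτ₀ hq hq2 (le_of_max_le_right hA) b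
  · exact DoubleSpend.isEquivalent_revenueRatio hτ₀ hb hz (le_of_max_le_right hA) hv
  · obtain ⟨δ, hδ, hδ2, h⟩ := DoubleSpend.exists_revenueRatio_bounds hτ₀ hb hz hε
    exact ⟨δ, hδ, hδ2, fun q hq hqδ A hA => h q hq hqδ A (le_of_max_le_right hA) v hv⟩
  · exact DoubleSpend.isEquivalent_minimalAmount hτ₀ hb hz (le_of_max_le_right hA)
  · obtain ⟨δ, hδ, hδ2, h⟩ := DoubleSpend.exists_profitable_bounds hτ₀ hb hz hε
    exact ⟨δ, hδ, hδ2, fun q hq hqδ A hA => h q hq hqδ A (le_of_max_le_right hA)⟩
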